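/- Let $\mathbb F_q$ be a finite field of odd cardinality $q$ and $A=\mathbb F_q[x]$. For $f\in A$ put $|f|=q^{\deg f}$ if $f\ne0$ and $|0|=0$, and let $\zeta_A(s)=\sum_{f\ \mathrm{monic}}|f|^{-s}$, continued to $\mathbb C$ by $\zeta_A(s)=1/(1-q^{1-s})$. Let $\mathcal H_{2g+1,q}$ be the set of monic square-free $D\in A$ of degree $2g+1$, let $\chi_D(f)=\left(\frac Df\right)$ be the quadratic (Jacobi) residue symbol of $D$ at a monic $f$, and let $$L(s,\chi_D)=\sum_{n\ge0}\Big(\sum_{f\ \mathrm{monic},\ \deg f=n}\chi_D(f)\Big)q^{-ns},$$ which for $D\in\mathcal H_{2g+1,q}$ is a polynomial in $q^{-s}$. Let $k\ge1$ be an integer. Define the Euler product over monic irreducible $P\in A$ $$A(\tfrac12;z_1,\dots,z_k)=\prod_P\ \prod_{1\le i\le j\le k}\Big(1-\frac1{|P|^{1+z_i+z_j}}\Big)\cdot\Big(\frac12\Big(\prod_{j=1}^k\Big(1-\frac1{|P|^{1/2+z_j}}\Big)^{-1}+\prod_{j=1}^k\Big(1+\frac1{|P|^{1/2+z_j}}\Big)^{-1}\Big)+\frac1{|P|}\Big)\Big(1+\frac1{|P|}\Big)^{-1},$$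 and, with $X(s)=q^{-1/2+s}$ and $\Delta(w_1,\dots,w_k)=\prod_{i<j}(w_j-w_i)$, $$G(z_1,\dots,z_k)=A(\tfrac12;z_1,\dots,z_k)\prod_{j=1}^kX(\tfrac12+z_j)^{-1/2}\prod_{1\le i\le j\le k}\zeta_A(1+z_i+z_j),$$ $$Q_k(x)=\frac{(-1)^{k(k-1)/2}2^k}{k!}\frac1{(2\pi i)^k}\oint\cdots\oint\frac{G(z_1,\dots,z_k)\,\Delta(z_1^2,\dots,z_k^2)^2}{\prod_{j=1}^kz_j^{2k-1}}\,q^{\frac x2\sum_{j=1}^kz_j}\,dz_1\cdots dz_k,$$ where all the contours are the circle $|z_j|=r$, for a fixed radius $r$ with $0<r<\min(\tfrac14,\pi/\log q)$, traversed once anticlockwise, and the power $-1/2$ is the principal one. **Theorem.** Fix $q$ and $k$ as above, and assume that the moment conjecture for the exponent $k$ holds, namely that, as $g\to\infty$, $$\sum_{D\in\mathcal H_{2g+1,q}}L(\tfrac12,\chi_D)^k=\Big(\sum_{D\in\mathcal H_{2g+1,q}}Q_k(\log_q|D|)\Big)(1+o(1)).$$ Then, as $g\to\infty$, writing $|D|=q^{2g+1}$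 for the common norm of the $D\in\mathcal H_{2g+1,q}$, $$\sum_{D\in\mathcal H_{2g+1,q}}L(\tfrac12,\chi_D)^k\sim\frac{|D|}{\zeta_A(2)}\,(\log_q|D|)^{k(k+1)/2}\,A(\tfrac12;0,\dots,0)\prod_{j=1}^k\frac{j!}{(2j)!}.$$ -/

import Mathlib

open Polynomial Filter Asymptotics
open scoped Real Topology

noncomputable section

namespace HyperellipticMoments

variable (F : Type*) [Field F] [Fintype F]

/-- The cardinality `q` of the finite field of constants. -/
def q : ℕ := Fintype.card F

variable {F}

/-- The norm `|f| = q ^ deg f` of a polynomial, with `|0| = 0`. -/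
def polyNorm (f : F[X]) : ℝ :=
  open Classical in if f = 0 then 0 else (q F : ℝ) ^ f.natDegree

variable (F) in
theorem finite_monic (n : ℕ) : {f : F[X] | f.Monic ∧ f.natDegree = n}.Finite := by
  have hinj : Set.InjOn (fun (f : F[X]) (i : Fin (n + 1)) => f.coeff i)
      {f : F[X] | f.Monic ∧ f.natDegree = n} := by
    intro f hf g hg h
    ext i
    by_cases hi : i < n + 1
    · exact congrFun h ⟨i, hi⟩
    · rw [coeff_eq_zero_of_natDegree_lt (by have := hf.2; omega),
        coeff_eq_zero_of_natDegree_lt (by have := hg.2; omega)]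
  exact Set.Finite.of_finite_image (Set.toFinite _) hinj

variable (F) in
/-- The monic polynomials of degree `n`. -/
def monics (n : ℕ) : Finset F[X] := (finite_monic F n).toFinset

theorem mem_monics {n : ℕ} {f : F[X]} : f ∈ monics F n ↔ f.Monic ∧ f.natDegree = n := by
  simp [monics]

variable (F) in
/-- The hyperelliptic ensemble `H_{d,q}`: the square-free monic polynomials of degree `d`. -/
def ensemble (d : ℕ) : Finset F[X] :=
  open Classical in (monics F d).filter Squarefree

/-- The quadratic residue symbol `(D / P)` for `P` irreducible. -/
def residueSymbol (D P : F[X]) : ℤ :=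
  open Classical in
  if P ∣ D then 0
  else if IsSquare (Ideal.Quotient.mk (Ideal.span {P}) D) then 1
  else -1

/-- The quadratic character `χ_D(f) = (D / f)` at a monic `f` (Jacobi symbol): the product of the
symbols `(D / P)` over the monic irreducible factors `P` of `f`, counted with multiplicity. -/
def chi (D f : F[X]) : ℤ :=
  open Classical in
  ((UniqueFactorizationMonoid.normalizedFactors f).map (residueSymbol D)).prod

/-- `A_D(n)`, the sum of `χ_D(f)` over the monic `f` of degree `n`. -/
def charSum (D : F[X]) (n : ℕ) : ℤ := ∑ f ∈ monics F n, chi D f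

/-- `L(s, χ_D) = ∑_{n ≥ 0} A_D(n) q^{-ns}`. For `D` of odd degree only the terms with `n < deg D`
are nonzero, so that this is defined for every complex `s`. -/
def LFunction (D : F[X]) (s : ℂ) : ℂ :=
  ∑' n : ℕ, (charSum D n : ℂ) * ((q F : ℂ) ^ (-s)) ^ n

variable (F) in
/-- The zeta function of `A = F[x]`, continued to the complex plane: `ζ_A(s) = 1 / (1 - q^{1-s})`.
See `hasSum_zetaA` for the Dirichlet series. -/
def zetaA (s : ℂ) : ℂ := 1 / (1 - (q F : ℂ) ^ (1 - s))

theorem card_monics (n : ℕ) : (monics F n).card = q F ^ n := by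
  classical
  have e : {f : F[X] // f.Monic ∧ f.natDegree = n} ≃ (Fin n → F) :=
    (monicEquivDegreeLT n).trans (degreeLTEquiv F n).toEquiv
  have h1 : Nat.card {f : F[X] // f.Monic ∧ f.natDegree = n} = (monics F n).card := by
    rw [monics]
    exact (Set.ncard_eq_toFinset_card _ (finite_monic F n))
  rw [← h1, Nat.card_congr e, Nat.card_eq_fintype_card]
  simp [q]

/-- The Dirichlet series of `ζ_A`: the sum of `|f|^{-s}` over all monic `f`, for `Re s > 1`. -/
theorem hasSum_zetaA {s : ℂ} (hs : 1 < s.re) :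
    HasSum (fun f : {f : F[X] // f.Monic} => (polyNorm f.1 : ℂ) ^ (-s)) (zetaA F s) := by
  classical
  have hq1 : 1 < q F := Fintype.one_lt_card
  have hq0 : (0 : ℝ) < q F := by exact_mod_cast (by omega : 0 < q F)
  have hqc : (q F : ℂ) ≠ 0 := by exact_mod_cast (by omega : q F ≠ 0)
  have hnorm (n : ℕ) (f : {f : F[X] // f ∈ monics F n}) :
      (polyNorm f.1 : ℂ) ^ (-s) = ((q F : ℂ) ^ (-s)) ^ n := by
    have hf : f.1.Monic ∧ f.1.natDegree = n := mem_monics.1 f.2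
    rw [polyNorm, if_neg hf.1.ne_zero, hf.2, ← Complex.cpow_nat_mul]
    push_cast
    rw [← Nat.cast_pow, Complex.natCast_cpow_natCast_mul, Nat.cast_pow]
  let e : (Σ n : ℕ, {f : F[X] // f ∈ monics F n}) ≃ {f : F[X] // f.Monic} :=
    { toFun := fun x => ⟨x.2.1, (mem_monics.1 x.2.2).1⟩
      invFun := fun f => ⟨f.1.natDegree, f.1, mem_monics.2 ⟨f.2, rfl⟩⟩
      left_inv := by
        rintro ⟨n, f, hf⟩
        rw [mem_monics] at hf
        obtain ⟨h1, rfl⟩ := hf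
        rfl
      right_inv := fun f => rfl }
  have hr : (q F : ℂ) * (q F : ℂ) ^ (-s) = (q F : ℂ) ^ (1 - s) := by
    rw [sub_eq_add_neg, Complex.cpow_add _ _ hqc, Complex.cpow_one]
  have hlt : ‖(q F : ℂ) ^ (1 - s)‖ < 1 := by
    rw [Complex.norm_natCast_cpow_of_pos (by omega)]
    exact Real.rpow_lt_one_of_one_lt_of_neg (by exact_mod_cast hq1) (by simp; linarith)
  have hcard (n : ℕ) : Fintype.card {f : F[X] // f ∈ monics F n} = q F ^ n := by
    rw [Fintype.card_coe, card_monics]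
  have hsum : Summable (fun x : Σ n : ℕ, {f : F[X] // f ∈ monics F n} =>
      ((q F : ℂ) ^ (-s)) ^ x.1) := by
    apply Summable.of_norm
    rw [summable_sigma_of_nonneg (fun _ => norm_nonneg _)]
    refine ⟨fun n => (hasSum_fintype _).summable, ?_⟩
    refine (summable_geometric_of_lt_one (norm_nonneg _) hlt).congr (fun n => ?_)
    rw [tsum_fintype]
    simp only [Finset.sum_const, Finset.card_univ, hcard, ← hr]
    simp [mul_pow]
  rw [← e.hasSum_iff]
  have h2 : HasSum (fun x : Σ n : ℕ, {f : F[X] // f ∈ monics F n} =>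
      ((q F : ℂ) ^ (-s)) ^ x.1) (zetaA F s) := by
    rw [hsum.hasSum_iff, hsum.tsum_sigma]
    rw [zetaA, one_div, ← tsum_geometric_of_norm_lt_one hlt]
    refine tsum_congr (fun n => ?_)
    rw [tsum_fintype]
    simp only [Finset.sum_const, Finset.card_univ, hcard, ← hr]
    simp [mul_pow]
  convert h2 using 2 with x
  exact hnorm x.1 x.2

variable (F) in
/-- `X(s) = q^{-1/2+s}`, a factor of the functional equation
`L(s, χ_D) = |D|^{1/2-s} X(s) L(1-s, χ_D)`. -/
def Xfactor (s : ℂ) : ℂ := (q F : ℂ) ^ (-(1 / 2) + s)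

variable (F) in
/-- The primes of `F[x]`: the monic irreducible polynomials. -/
abbrev PrimePoly : Type _ := {P : F[X] // P.Monic ∧ Irreducible P}

variable (F) in
/-- The Euler product `A(1/2; z_1, …, z_k)`. -/
def eulerA {k : ℕ} (z : Fin k → ℂ) : ℂ :=
  ∏' P : PrimePoly F,
    (∏ i, ∏ j ∈ Finset.Ici i, (1 - 1 / (polyNorm P.1 : ℂ) ^ (1 + z i + z j)))
    * (1 / 2 * ((∏ j, (1 - 1 / (polyNorm P.1 : ℂ) ^ (1 / 2 + z j))⁻¹)
                + ∏ j, (1 + 1 / (polyNorm P.1 : ℂ) ^ (1 / 2 + z j))⁻¹)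
        + 1 / (polyNorm P.1 : ℂ))
    * (1 + 1 / (polyNorm P.1 : ℂ))⁻¹

variable (F) in
/-- `G(z_1, …, z_k) = A(1/2; z) ∏_j X(1/2 + z_j)^{-1/2} ∏_{i ≤ j} ζ_A(1 + z_i + z_j)`, with the
branch of the power that is `1` at `z_j = 0`. -/
def G {k : ℕ} (z : Fin k → ℂ) : ℂ :=
  eulerA F z * (∏ j, (Xfactor F (1 / 2 + z j)) ^ (-(1 / 2) : ℂ))
    * ∏ i, ∏ j ∈ Finset.Ici i, zetaA F (1 + z i + z j)

/-- The Vandermonde product `Δ(w_1, …, w_k) = ∏_{i < j} (w_j - w_i)`. -/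
def vandermonde {k : ℕ} (w : Fin k → ℂ) : ℂ := ∏ i, ∏ j ∈ Finset.Ioi i, (w j - w i)

variable (F) in
/-- The `k`-fold contour integral `Q_k(x)`, taken over the circles `|z_j| = r`. For small `r` it does
not depend on `r`: the singularities of the integrand along `z_i + z_j = 0`, `i < j`, are removable
because of the factor `Δ(z_1^2, …, z_k^2)^2`. -/
def Q (k : ℕ) (r : ℝ) (x : ℝ) : ℂ :=
  (-1) ^ (k * (k - 1) / 2) * 2 ^ k / (k.factorial : ℂ) * (1 / (2 * π * Complex.I) ^ k)
    * torusIntegral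
        (fun z : Fin k → ℂ =>
          G F z * vandermonde (fun j => z j ^ 2) ^ 2 / (∏ j, z j ^ (2 * k - 1))
            * (q F : ℂ) ^ ((x : ℂ) / 2 * ∑ j, z j))
        (fun _ => 0) (fun _ => r)

variable (F) in
/-- The moment conjecture for the exponent `k`, with `Q_k` computed on the circles `|z_j| = r`:
`∑_D L(1/2, χ_D)^k = ∑_D Q_k(log_q |D|) (1 + o(1))` as `g → ∞`, both sums over `D ∈ H_{2g+1,q}`. -/
def MomentConjecture (k : ℕ) (r : ℝ) : Prop :=
  (fun g : ℕ => ∑ D ∈ ensemble F (2 * g + 1), LFunction D (1 / 2) ^ k)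
    ~[atTop]
  (fun g : ℕ => ∑ D ∈ ensemble F (2 * g + 1), Q F k r (Real.logb (q F) (polyNorm D)))

end HyperellipticMoments

end

noncomputable section

namespace HyperellipticMoments

/-! All `D` in the ensemble have the same norm, so the conjecture turns the moment into
`#H_{2g+1,q}` times one value of `Q_k`. What remains is the count `q ^ n / ζ_A(2)` for `n ≥ 2`
(`card_ensemble`) and the growth of `Q_k(x)` (`isEquivalent_Q`).

Each `ζ_A(1 + z_i + z_j)` is a holomorphic function divided by `z_i + z_j`, and `Δ(z²)²` absorbs the
off-diagonal denominators. The integrand becomes a function `regularPart`, holomorphic near `0`,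
times the explicit `kernel` `Δ(z) Δ(z²) ∏ z_j^{-2k} e^{λ z_j}` with `λ = x log q / 2`
(`integrand_eq`). Shrinking the circles to radius `1/λ` and setting `z = w/λ` extracts
`λ^{k(k+1)/2}`, and dominated convergence replaces `regularPart` by its value at `0`
(`torusIntegral_regularPart_mul_kernel`, `tendsto_torusIntegral_scaled`).

The remaining constant integral is `k!` times a determinant of reciprocal factorials, which reduces
to a Vandermonde determinant (`torusIntegral_vandermonde_mul_exp`, `det_expCoeff`). The analytic
input is that each local factor is `1 + O(|P|^{-2+4r})`, so the Euler product converges on the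
polydisc of radius `r < 1/4` and is nonzero at the origin. -/

/-! ### Integrals over tori: Fubini, change of radius, scaling, products -/

theorem torusIntegrable_of_continuous {n : ℕ} {f : (Fin n → ℂ) → ℂ} {R : Fin n → ℝ}
    (hf : Continuous fun θ => f (torusMap 0 R θ)) : TorusIntegrable f 0 R :=
  hf.continuousOn.integrableOn_compact isCompact_Icc

theorem continuous_torusMap {n : ℕ} (R : Fin n → ℝ) : Continuous (torusMap 0 R) := by
  unfold torusMap
  fun_prop

theorem norm_torusMap_const {n : ℕ} {r : ℝ} (hr : 0 ≤ r) (θ : Fin n → ℝ) (j : Fin n) :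
    ‖torusMap 0 (fun _ => r) θ j‖ = r := by
  simp [torusMap, Complex.norm_exp_ofReal_mul_I, abs_of_nonneg hr]

theorem torusIntegral_congr {n : ℕ} {f g : (Fin n → ℂ) → ℂ} {r : ℝ} (hr : 0 ≤ r)
    (h : ∀ z : Fin n → ℂ, (∀ j, ‖z j‖ = r) → f z = g z) :
    torusIntegral f (fun _ => 0) (fun _ => r) = torusIntegral g (fun _ => 0) (fun _ => r) := by
  unfold torusIntegral
  congr 1 with θ
  exact congrArg _ (h _ (norm_torusMap_const hr θ))

/-- Fubini for a circle integral and a torus integral. -/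
theorem circleIntegral_torusIntegral_comm {n : ℕ} {g : ℂ → (Fin n → ℂ) → ℂ} {a : ℝ}
    {R : Fin n → ℝ}
    (hg : Continuous fun p : ℝ × (Fin n → ℝ) => g (circleMap 0 a p.1) (torusMap 0 R p.2)) :
    (∮ x in C(0, a), torusIntegral (fun y => g x y) 0 R)
      = torusIntegral (fun y => ∮ x in C(0, a), g x y) 0 R := by
  simp only [circleIntegral_def_Icc, torusIntegral, ← MeasureTheory.integral_smul]
  rw [MeasureTheory.integral_integral_swap]
  · congr 1 with Θ
    congr 1 with θ
    exact smul_comm _ _ _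
  · rw [MeasureTheory.Measure.prod_restrict]
    refine ContinuousOn.integrableOn_compact (isCompact_Icc.prod isCompact_Icc)
      (Continuous.continuousOn ?_)
    simp only [deriv_circleMap, Function.uncurry_def, smul_eq_mul]
    refine Continuous.mul ?_ (Continuous.mul ?_ hg)
    · unfold circleMap
      fun_prop
    · fun_prop

/-- A torus integral over polycircles does not depend on the common radius, as long as the
integrand is continuous on the closed polyannulus between the two radii and separately
holomorphic inside. -/
theorem torusIntegral_eq_of_differentiableOn_annulus {ρ r : ℝ} (hρ : 0 < ρ) (hr : ρ ≤ r) :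
    ∀ {n : ℕ} {f : (Fin n → ℂ) → ℂ},
      ContinuousOn f {z | ∀ j, ρ ≤ ‖z j‖ ∧ ‖z j‖ ≤ r} →
      (∀ z : Fin n → ℂ, (∀ j, ρ ≤ ‖z j‖ ∧ ‖z j‖ ≤ r) → ∀ j,
        DifferentiableOn ℂ (fun w => f (Function.update z j w)) {w | ρ < ‖w‖ ∧ ‖w‖ < r}) →
      torusIntegral f (fun _ => 0) (fun _ => r) = torusIntegral f (fun _ => 0) (fun _ => ρ) := by
  intro n
  induction n with
  | zero => intro f _ _; simp
  | succ n ih =>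
    intro f hc hd
    have hr0 : 0 < r := hρ.trans_le hr
    have hbd {s : ℝ} (h : s = ρ ∨ s = r) : 0 ≤ s ∧ ρ ≤ s ∧ s ≤ r := by
      rcases h with rfl | rfl
      · exact ⟨hρ.le, le_rfl, hr⟩
      · exact ⟨hr0.le, hr, le_rfl⟩
    have hint {s : ℝ} (h : s = ρ ∨ s = r) : TorusIntegrable f 0 (fun _ => s) := by
      refine torusIntegrable_of_continuous (hc.comp_continuous (continuous_torusMap _) ?_)
      intro θ j
      rw [norm_torusMap_const (hbd h).1]
      exact (hbd h).2
    have hcomm {s t : ℝ} (h : s = ρ ∨ s = r) (h' : t = ρ ∨ t = r) :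
        Continuous fun p : ℝ × (Fin n → ℝ) =>
          f (Fin.cons (circleMap 0 s p.1) (torusMap 0 (fun _ => t) p.2) : Fin (n + 1) → ℂ) := by
      refine hc.comp_continuous (Continuous.finCons ?_ ?_) ?_
      · exact (continuous_circleMap 0 s).comp continuous_fst
      · exact (continuous_torusMap _).comp continuous_snd
      · intro p j
        refine Fin.cases ?_ (fun i => ?_) j
        · simpa [abs_of_nonneg (hbd h).1] using (hbd h).2
        · simpa [norm_torusMap_const (hbd h').1] using (hbd h').2
    have e1 := torusIntegral_succ (hint (Or.inr rfl))
    have e2 := torusIntegral_succ (hint (Or.inl rfl))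
    simp only [Function.comp_def, Pi.zero_apply] at e1 e2
    -- Induction moves the last `n` variables to radius `ρ` while the first stays on radius `r`.
    -- Fubini then makes the first variable innermost, Cauchy's theorem on the annulus moves it, and
    -- Fubini restores the order.
    have step1 : (∮ x in C(0, r), torusIntegral (fun y => f (Fin.cons x y)) (fun _ => 0)
        (fun _ => r)) = ∮ x in C(0, r), torusIntegral (fun y => f (Fin.cons x y)) (fun _ => 0)
        (fun _ => ρ) := by
      refine circleIntegral.integral_congr hr0.le fun x hx => ?_
      have hx' : ‖x‖ = r := by simpa using hx
      refine ih (f := fun y => f (Fin.cons x y)) ?_ ?_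
      · refine hc.comp (Continuous.continuousOn (by fun_prop)) ?_
        intro y hy j
        refine Fin.cases ?_ (fun i => ?_) j
        · simp [hx', hr]
        · simpa using hy i
      · intro y hy j
        have := hd (Fin.cons x y) (fun j => by
          refine Fin.cases ?_ (fun i => ?_) j
          · simp [hx', hr]
          · simpa using hy i) j.succ
        simpa only [Fin.cons_update] using this
    have step2 : torusIntegral (fun y : Fin n → ℂ => ∮ x in C(0, r), f (Fin.cons x y)) (fun _ => 0)
        (fun _ => ρ) = torusIntegral (fun y => ∮ x in C(0, ρ), f (Fin.cons x y)) (fun _ => 0)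
        (fun _ => ρ) := by
      refine torusIntegral_congr hρ.le fun y hy => ?_
      refine Complex.circleIntegral_eq_of_differentiable_on_annulus_off_countable hρ hr
        Set.countable_empty (hc.comp (Continuous.continuousOn (by fun_prop)) ?_) ?_
      · rintro x ⟨hx1, hx2⟩ j
        refine Fin.cases ?_ (fun i => ?_) j
        · simpa using ⟨by simpa using hx2, by simpa using hx1⟩
        · simp [hy, hr]
      · rintro x ⟨⟨hx1, hx2⟩, -⟩
        -- The update overwrites the first coordinate, so any admissible value may stand there; `ρ`
        -- is one.
        have h0 := hd (Fin.cons (ρ : ℂ) y) (fun j => by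
          refine Fin.cases ?_ (fun i => ?_) j
          · simp [abs_of_pos hρ, hr]
          · simp [hy, hr]) 0
        simp only [Fin.update_cons_zero] at h0
        refine h0.differentiableAt (IsOpen.mem_nhds ?_ ?_)
        · exact (isOpen_lt continuous_const continuous_norm).inter
            (isOpen_lt continuous_norm continuous_const)
        · exact ⟨by simpa using hx2, by simpa using hx1⟩
    calc torusIntegral f (fun _ => 0) (fun _ => r) = _ := e1
      _ = _ := step1
      _ = _ := circleIntegral_torusIntegral_comm (hcomm (Or.inr rfl) (Or.inl rfl))
      _ = _ := step2
      _ = _ := (circleIntegral_torusIntegral_comm (hcomm (Or.inl rfl) (Or.inl rfl))).symm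
      _ = _ := e2.symm

theorem torusIntegral_scale {n : ℕ} (f : (Fin n → ℂ) → ℂ) (a : ℝ) :
    torusIntegral f (fun _ => 0) (fun _ => a)
      = (a : ℂ) ^ n * torusIntegral (fun w => f (fun j => a * w j)) (fun _ => 0) (fun _ => 1) := by
  rw [← torusIntegral_const_mul]
  unfold torusIntegral
  congr 1 with θ
  have h : torusMap (fun _ => 0) (fun _ => a) θ
      = fun j => (a : ℂ) * torusMap (fun _ => 0) (fun _ => 1) θ j := by
    ext j
    simp [torusMap]
  rw [h]
  simp only [Finset.prod_mul_distrib, smul_eq_mul]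
  simp
  ring

theorem torusIntegral_finset_sum {n : ℕ} {ι : Type*} (s : Finset ι) {f : ι → (Fin n → ℂ) → ℂ}
    {R : Fin n → ℝ} (hf : ∀ i ∈ s, TorusIntegrable (f i) 0 R) :
    torusIntegral (fun z => ∑ i ∈ s, f i z) 0 R = ∑ i ∈ s, torusIntegral (f i) 0 R := by
  unfold torusIntegral
  rw [← MeasureTheory.integral_finsetSum]
  · simp only [Finset.smul_sum]
  · exact fun i hi => (hf i hi).function_integrable

theorem torusIntegral_prod {n : ℕ} (g : Fin n → ℂ → ℂ) (a : ℝ)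
    (hg : ∀ j, Continuous fun θ : ℝ => g j (circleMap 0 a θ)) :
    torusIntegral (fun z => ∏ j, g j (z j)) (fun _ => 0) (fun _ => a)
      = ∏ j, ∮ x in C(0, a), g j x := by
  induction n with
  | zero => simp
  | succ n ih =>
    have hint : TorusIntegrable (fun z : Fin (n + 1) → ℂ => ∏ j, g j (z j)) 0 (fun _ => a) := by
      refine torusIntegrable_of_continuous ?_
      refine continuous_finsetProd _ fun j _ => ?_
      exact (hg j).comp (continuous_apply j)
    rw [Fin.prod_univ_succ, ← ih (fun j => g j.succ) (fun j => hg j.succ)]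
    refine (torusIntegral_succ hint).trans ?_
    simp only [Function.comp_def, Pi.zero_apply, Fin.prod_univ_succ, Fin.cons_zero,
      Fin.cons_succ, torusIntegral_const_mul]
    simp only [← smul_eq_mul]
    exact circleIntegral.integral_smul_const _ _ _ _

/-! ### Vandermonde determinants and the constant integral -/

theorem prod_prod_Ioi_const {M : Type*} [CommMonoid M] (k : ℕ) (c : M) :
    ∏ i : Fin k, ∏ _j ∈ Finset.Ioi i, c = c ^ (k * (k - 1) / 2) := by
  simp only [Finset.prod_const, Fin.card_Ioi, Finset.prod_pow_eq_pow_sum]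
  rw [Fin.sum_univ_eq_sum_range (fun i => k - 1 - i) k, Finset.sum_range_reflect (fun i => i) k,
    Finset.sum_range_id]

theorem vandermonde_eq_det {k : ℕ} (w : Fin k → ℂ) :
    vandermonde w = (Matrix.vandermonde w).det :=
  (Matrix.det_vandermonde w).symm

theorem vandermonde_const_mul {k : ℕ} (c : ℂ) (w : Fin k → ℂ) :
    vandermonde (fun j => c * w j) = c ^ (k * (k - 1) / 2) * vandermonde w := by
  simp only [vandermonde, ← mul_sub, Finset.prod_mul_distrib, prod_prod_Ioi_const]

/-- The coefficient of `w ^ (n - 1)` in `w ^ m * exp w`. -/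
def expCoeff (n m : ℕ) : ℂ := if m < n then 1 / ((n - 1 - m).factorial : ℂ) else 0

/-- For `m < n` this is Cauchy's formula for a derivative of `exp` at `0`; for `m ≥ n` the integrand
extends to an entire function and the integral vanishes. -/
theorem circleIntegral_pow_mul_exp (n m : ℕ) :
    (∮ z in C(0, 1), z ^ m * ((z ^ n)⁻¹ * Complex.exp z)) = 2 * π * Complex.I * expCoeff n m := by
  have hne {z : ℂ} (hz : z ∈ Metric.sphere (0 : ℂ) 1) : z ≠ 0 := by
    rintro rfl
    simp at hz
  unfold expCoeff
  split_ifs with h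
  · obtain ⟨d, rfl⟩ := Nat.exists_eq_add_of_lt h
    have e := DifferentiableOn.circleIntegral_one_div_sub_center_pow_smul (f := Complex.exp)
      (c := 0) one_pos d Complex.differentiable_exp.differentiableOn
    rw [iteratedDeriv_eq_iterate, Complex.iter_deriv_exp] at e
    rw [show m + d + 1 - 1 - m = d by omega]
    rw [Complex.exp_zero, smul_eq_mul, mul_one] at e
    rw [← mul_div_assoc, mul_one, ← e]
    refine circleIntegral.integral_congr zero_le_one fun z hz => ?_
    have := hne hz
    simp only [sub_zero, smul_eq_mul]
    field_simp
    ring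
  · obtain ⟨d, rfl⟩ := Nat.exists_eq_add_of_le (not_lt.1 h)
    have hd : Differentiable ℂ fun z : ℂ => z ^ d * Complex.exp z := by fun_prop
    have e : (∮ z in C(0, 1), z ^ d * Complex.exp z) = 0 :=
      Complex.circleIntegral_eq_zero_of_differentiable_on_off_countable zero_le_one
        Set.countable_empty hd.continuous.continuousOn fun z _ => hd z
    refine Eq.trans ?_ (e.trans (mul_zero _).symm)
    refine circleIntegral.integral_congr zero_le_one fun z hz => ?_
    have := hne hz
    field_simp
    ring

theorem vandermonde_mul_vandermonde_sq_expansion {k : ℕ} (g : ℂ → ℂ) (w : Fin k → ℂ) :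
    vandermonde w * vandermonde (fun j => w j ^ 2) * ∏ j, g (w j)
      = ∑ p : Equiv.Perm (Fin k) × Equiv.Perm (Fin k),
          ((Equiv.Perm.sign p.1 : ℤ) : ℂ) * ((Equiv.Perm.sign p.2 : ℤ) : ℂ)
            * ∏ j, (w j ^ ((p.1 j : ℕ) + 2 * (p.2 j : ℕ)) * g (w j)) := by
  have h (v : Fin k → ℂ) : vandermonde v
      = ∑ σ : Equiv.Perm (Fin k), ((Equiv.Perm.sign σ : ℤ) : ℂ) * ∏ j, v j ^ (σ j : ℕ) := by
    rw [vandermonde_eq_det, ← Matrix.det_transpose, Matrix.det_apply']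
    rfl
  rw [h, h, Finset.sum_mul_sum, ← Finset.sum_product', Finset.sum_mul]
  refine Finset.sum_congr rfl fun p _ => ?_
  simp only [Finset.prod_mul_distrib, pow_add, pow_mul]
  ring

/-- For fixed `τ` the sum over `σ` is `sign τ` times the determinant with columns permuted by `τ`,
and the two signs cancel. Each of the `k!` choices of `τ` thus contributes `det N`. -/
theorem sum_perm_perm_eq_det {k : ℕ} (N : Matrix (Fin k) (Fin k) ℂ) :
    ∑ p : Equiv.Perm (Fin k) × Equiv.Perm (Fin k),
          ((Equiv.Perm.sign p.1 : ℤ) : ℂ) * ((Equiv.Perm.sign p.2 : ℤ) : ℂ) * ∏ j, N (p.1 j) (p.2 j)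
      = k.factorial * N.det := by
  rw [Fintype.sum_prod_type_right]
  have h (τ : Equiv.Perm (Fin k)) : ∑ σ : Equiv.Perm (Fin k), ((Equiv.Perm.sign σ : ℤ) : ℂ)
      * ((Equiv.Perm.sign τ : ℤ) : ℂ) * ∏ j, N (σ j) (τ j) = N.det := by
    have h1 := Matrix.det_permute' τ N
    rw [Matrix.det_apply'] at h1
    simp only [Matrix.submatrix_apply, id] at h1
    calc _ = ((Equiv.Perm.sign τ : ℤ) : ℂ) * ∑ σ : Equiv.Perm (Fin k),
          ((Equiv.Perm.sign σ : ℤ) : ℂ) * ∏ j, N (σ j) (τ j) := by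
            rw [Finset.mul_sum]
            exact Finset.sum_congr rfl fun σ _ => by ring
      _ = _ := by
        rw [h1, ← mul_assoc, ← Int.cast_mul, ← Units.val_mul, Int.units_mul_self]
        simp
  simp only [h]
  simp [Fintype.card_perm]

/-- Andréief's identity: after the Leibniz expansion of both Vandermonde determinants every term is
a product of one-variable integrals, and the double sum over permutations collapses to one
determinant. -/
theorem torusIntegral_vandermonde_mul_exp (k n : ℕ) :
    torusIntegral (fun w : Fin k → ℂ => vandermonde w * vandermonde (fun j => w j ^ 2)
        * ∏ j, ((w j ^ n)⁻¹ * Complex.exp (w j))) (fun _ => 0) (fun _ => 1)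
      = (2 * π * Complex.I) ^ k
        * (k.factorial * (Matrix.of fun i j : Fin k => expCoeff n (i + 2 * j)).det) := by
  have hcirc (θ : ℝ) : circleMap 0 1 θ ≠ 0 := circleMap_ne_center one_ne_zero
  have hcont (m : ℕ) : Continuous fun θ : ℝ =>
      circleMap 0 1 θ ^ m * ((circleMap 0 1 θ ^ n)⁻¹ * Complex.exp (circleMap 0 1 θ)) := by
    have := continuous_circleMap 0 1
    refine (this.pow m).mul (((this.pow n).inv₀ fun θ => pow_ne_zero _ (hcirc θ)).mul ?_)
    fun_prop
  simp only [vandermonde_mul_vandermonde_sq_expansion (fun x => (x ^ n)⁻¹ * Complex.exp x)]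
  refine (torusIntegral_finset_sum Finset.univ (R := fun _ => 1) fun p _ => ?_).trans ?_
  · refine torusIntegrable_of_continuous (continuous_const.mul ?_)
    exact continuous_finsetProd _ fun j _ => (hcont _).comp (continuous_apply j)
  · rw [← sum_perm_perm_eq_det, Finset.mul_sum]
    refine Finset.sum_congr rfl fun p _ => ?_
    rw [torusIntegral_const_mul]
    refine (congrArg _ (torusIntegral_prod (fun j x => x ^ ((p.1 j : ℕ) + 2 * (p.2 j : ℕ))
      * ((x ^ n)⁻¹ * Complex.exp x)) 1 fun j => hcont _)).trans ?_
    simp only [circleIntegral_pow_mul_exp, Finset.prod_mul_distrib, Finset.prod_const,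
      Finset.card_univ, Fintype.card_fin, Matrix.of_apply]
    ring

/-- With `v_j = 2k - 1 - 2j` the entries are `1/(v_j - i)!`, that is, `1/v_j!` times the falling
factorial of `v_j` of length `i`. Falling factorials are monic of degree `i`, so their determinant
is the Vandermonde of the `v_j`; differences of these nodes are `-2` times differences of indices.
-/
theorem det_expCoeff (k : ℕ) :
    (Matrix.of fun i j : Fin k => expCoeff (2 * k) (i + 2 * j)).det
      = (-2) ^ (k * (k - 1) / 2) * (vandermonde (fun j : Fin k => ((j : ℕ) : ℂ))
        * ∏ j : Fin k, 1 / ((2 * k - 1 - 2 * j).factorial : ℂ)) := by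
  set v : Fin k → ℂ := fun j => ((2 * k - 1 - 2 * j : ℕ) : ℂ) with hv
  have h1 : (Matrix.of fun i j : Fin k => expCoeff (2 * k) (i + 2 * j))
      = Matrix.of fun i j : Fin k => (1 / ((2 * k - 1 - 2 * j : ℕ).factorial : ℂ))
          * (Matrix.of fun i j : Fin k => (descPochhammer ℂ (j : ℕ)).eval (v i)).transpose i j := by
    ext i j
    have hi := i.2
    have hj := j.2
    simp only [Matrix.of_apply, Matrix.transpose_apply, hv, descPochhammer_eval_eq_descFactorial,
      expCoeff]
    split_ifs with h
    · have h2 := Nat.factorial_mul_descFactorial (n := 2 * k - 1 - 2 * j) (k := i) (by omega)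
      rw [show 2 * k - 1 - (i + 2 * j : ℕ) = 2 * k - 1 - 2 * j - i by omega, ← h2]
      have h3 : ((2 * k - 1 - 2 * j - i : ℕ).factorial : ℂ) ≠ 0 :=
        Nat.cast_ne_zero.2 (Nat.factorial_ne_zero _)
      have h4 : ((2 * k - 1 - 2 * j : ℕ).descFactorial i : ℂ) ≠ 0 := by
        rw [Nat.cast_ne_zero, Ne, Nat.descFactorial_eq_zero_iff_lt]
        omega
      push_cast
      field_simp
    -- Where `expCoeff` is `0` by definition, the falling factorial vanishes as well.
    · rw [Nat.descFactorial_eq_zero_iff_lt.2 (by omega)]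
      simp
  rw [h1, Matrix.det_mul_row, Matrix.det_transpose,
    ← Matrix.det_eval_matrixOfPolynomials_eq_det_vandermonde v _
      (fun i => descPochhammer_natDegree ℂ i) (fun i => monic_descPochhammer ℂ i),
    Matrix.det_vandermonde]
  have h5 : ∏ i : Fin k, ∏ j ∈ Finset.Ioi i, (v j - v i)
      = (-2) ^ (k * (k - 1) / 2) * vandermonde (fun j : Fin k => ((j : ℕ) : ℂ)) := by
    rw [← vandermonde_const_mul]
    refine Finset.prod_congr rfl fun i _ => Finset.prod_congr rfl fun j _ => ?_
    have hi := i.2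
    have hj := j.2
    simp only [hv]
    rw [Nat.sub_sub, Nat.sub_sub, Nat.cast_sub (by omega), Nat.cast_sub (by omega)]
    push_cast
    ring
  rw [h5]
  ring

theorem vandermonde_id (k : ℕ) :
    vandermonde (fun j : Fin k => ((j : ℕ) : ℂ)) = ∏ i ∈ Finset.range k, (i.factorial : ℂ) := by
  rcases k with - | k
  · simp [vandermonde]
  · rw [vandermonde_eq_det, Matrix.det_vandermonde_id_eq_superFactorial,
      Finset.prod_range_succ']
    simpa using mod_cast (Nat.prod_range_factorial_succ k).symm

/-- After reversing the second product, `i!` meets `1/(2i+1)!`, and `i!/(2i+1)! = 2 (i+1)!/(2i+2)!`;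
this yields the factor `2 ^ k`. -/
theorem vandermonde_id_mul_prod (k : ℕ) :
    vandermonde (fun j : Fin k => ((j : ℕ) : ℂ))
        * ∏ j : Fin k, 1 / ((2 * k - 1 - 2 * j).factorial : ℂ)
      = 2 ^ k * ∏ j ∈ Finset.Icc 1 k, ((j.factorial : ℂ) / ((2 * j).factorial : ℂ)) := by
  rw [vandermonde_id, Fin.prod_univ_eq_prod_range
    (fun j => 1 / ((2 * k - 1 - 2 * j).factorial : ℂ)) k,
    ← Finset.prod_range_reflect (fun j => 1 / ((2 * k - 1 - 2 * j).factorial : ℂ)),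
    ← Finset.prod_mul_distrib, ← Finset.Ico_add_one_right_eq_Icc, Finset.prod_Ico_eq_prod_range]
  rw [show k + 1 - 1 = k by omega]
  conv_rhs => rw [← Finset.card_range k, ← Finset.prod_const, Finset.card_range,
    ← Finset.prod_mul_distrib]
  refine Finset.prod_congr rfl fun i hi => ?_
  have hi' := Finset.mem_range.1 hi
  rw [show 2 * k - 1 - 2 * (k - 1 - i) = 2 * i + 1 by omega,
    show 2 * (1 + i) = 2 * i + 1 + 1 by ring, Nat.factorial_succ (2 * i + 1), add_comm 1 i,
    Nat.factorial_succ i]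
  have h3 : ((2 * i + 1).factorial : ℂ) ≠ 0 := Nat.cast_ne_zero.2 (Nat.factorial_ne_zero _)
  have h4 : (i : ℂ) + 1 ≠ 0 := by exact_mod_cast i.succ_ne_zero
  have h5 : (2 * i + 1 + 1 : ℂ) ≠ 0 := by exact_mod_cast (2 * i + 1).succ_ne_zero
  push_cast
  field_simp
  ring

/-! ### The local factor is `1` up to fourth order -/

section LocalFactor

theorem isBigO_prod_one_sub {X ι : Type*} {l : Filter X} {τ : X → ℝ}
    (hτ : τ =O[l] fun _ => (1 : ℝ)) (s : Finset ι) {y : ι → X → ℂ} (hy : ∀ i ∈ s, y i =O[l] τ) :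
    ((fun x => ∏ i ∈ s, (1 - y i x) - 1) =O[l] τ) ∧
      ((fun x => ∏ i ∈ s, (1 - y i x) - 1 + ∑ i ∈ s, y i x) =O[l] fun x => τ x * τ x) := by
  classical
  induction s using Finset.induction_on with
  | empty => simp [isBigO_zero]
  | insert a s ha ih =>
    obtain ⟨h1, h2⟩ := ih fun i hi => hy i (Finset.mem_insert_of_mem hi)
    have h3 := hy a (Finset.mem_insert_self _ _)
    have h4 : (fun x => y a x * (∏ i ∈ s, (1 - y i x) - 1)) =O[l] fun x => τ x * τ x := h3.mul h1
    have h5 : (fun x => τ x * τ x) =O[l] τ := by simpa using (isBigO_refl τ l).mul hτ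
    refine ⟨?_, ?_⟩
    · refine ((h1.sub h3).sub (h4.trans h5)).congr_left fun x => ?_
      rw [Finset.prod_insert ha]
      ring
    · refine (h2.sub h4).congr_left fun x => ?_
      rw [Finset.prod_insert ha, Finset.sum_insert ha]
      ring

/-- The expansion of the even part of `∏ (1 + u_i)` up to fourth order. -/
theorem isBigO_even_part {X ι : Type*} {l : Filter X} {t : X → ℝ}
    (ht : t =O[l] fun _ => (1 : ℝ)) (s : Finset ι) {u : ι → X → ℂ} (hu : ∀ i ∈ s, u i =O[l] t) :
    (fun x => 1 / 2 * (∏ i ∈ s, (1 + u i x) + ∏ i ∈ s, (1 - u i x)) - 1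
        - ((∑ i ∈ s, u i x) ^ 2 - ∑ i ∈ s, u i x ^ 2) / 2) =O[l] fun x => t x ^ 4 := by
  classical
  -- Inserting a factor mixes the even and odd parts of the product, so the induction carries both,
  -- each with its sharp expansion and a cruder bound.
  suffices H : ((fun x => 1 / 2 * (∏ i ∈ s, (1 + u i x) + ∏ i ∈ s, (1 - u i x)) - 1
        - ((∑ i ∈ s, u i x) ^ 2 - ∑ i ∈ s, u i x ^ 2) / 2) =O[l] fun x => t x ^ 4) ∧
      ((fun x => 1 / 2 * (∏ i ∈ s, (1 + u i x) - ∏ i ∈ s, (1 - u i x))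
        - ∑ i ∈ s, u i x) =O[l] fun x => t x ^ 3) ∧
      ((fun x => 1 / 2 * (∏ i ∈ s, (1 + u i x) + ∏ i ∈ s, (1 - u i x)) - 1)
        =O[l] fun x => t x ^ 2) ∧
      ((fun x => 1 / 2 * (∏ i ∈ s, (1 + u i x) - ∏ i ∈ s, (1 - u i x))) =O[l] t) from H.1
  induction s using Finset.induction_on with
  | empty => norm_num [isBigO_zero]
  | insert a s ha ih =>
    obtain ⟨h1, h2, h3, h4⟩ := ih fun i hi => hu i (Finset.mem_insert_of_mem hi)
    have h := hu a (Finset.mem_insert_self _ _)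
    have h5 : (fun x => t x * t x ^ 2) =O[l] t := by
      simpa using (isBigO_refl t l).mul (ht.pow 2)
    refine ⟨(h1.add ((h.mul h2).congr_right fun x => by ring)).congr_left fun x => ?_,
      (h2.add ((h.mul h3).congr_right fun x => by ring)).congr_left fun x => ?_,
      (h3.add ((h.mul h4).congr_right fun x => by ring)).congr_left fun x => ?_,
      ((h4.add h).add ((h.mul h3).trans h5)).congr_left fun x => ?_⟩
    all_goals
      simp only [Finset.prod_insert ha, Finset.sum_insert ha]
      ring

theorem sum_sum_Ioi_mul {k : ℕ} (u : Fin k → ℂ) :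
    ∑ i, ∑ j ∈ Finset.Ioi i, u i * u j = ((∑ i, u i) ^ 2 - ∑ i, u i ^ 2) / 2 := by
  induction k with
  | zero => simp
  | succ k ih =>
    rw [Fin.sum_univ_succ, Fin.sum_Ioi_zero]
    simp only [Fin.sum_Ioi_succ]
    rw [ih fun j => u j.succ, ← Finset.mul_sum, Fin.sum_univ_succ, Fin.sum_univ_succ]
    ring

/-- The factor of the Euler product `A(1/2; z)` in terms of `u_j = |P|^{-1/2-z_j}` and
`p = |P|^{-1}`, with the denominators cleared. -/
def localFactor {k : ℕ} (u : Fin k → ℂ) (p : ℂ) : ℂ :=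
  (∏ i, ∏ j ∈ Finset.Ioi i, (1 - u i * u j))
    * (1 / 2 * (∏ j, (1 + u j) + ∏ j, (1 - u j)) + p * ∏ j, (1 - u j ^ 2)) * (1 + p)⁻¹

/-- The diagonal factors `1 - u_j²` cancel the denominators of the two inverse products. -/
theorem localFactor_eq {k : ℕ} (u : Fin k → ℂ) (p : ℂ) (h1 : ∀ j, 1 - u j ≠ 0)
    (h2 : ∀ j, 1 + u j ≠ 0) :
    (∏ i, ∏ j ∈ Finset.Ici i, (1 - u i * u j))
      * (1 / 2 * (∏ j, (1 - u j)⁻¹ + ∏ j, (1 + u j)⁻¹) + p) * (1 + p)⁻¹ = localFactor u p := by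
  simp only [localFactor, ← Finset.mul_prod_Ioi_eq_prod_Ici, Finset.prod_mul_distrib,
    Finset.prod_inv_distrib]
  have h3 : ∏ j, (1 - u j) ≠ 0 := Finset.prod_ne_zero_iff.2 fun j _ => h1 j
  have h4 : ∏ j, (1 + u j) ≠ 0 := Finset.prod_ne_zero_iff.2 fun j _ => h2 j
  have h5 : ∏ j, (1 - u j ^ 2) = (∏ j, (1 - u j)) * ∏ j, (1 + u j) := by
    rw [← Finset.prod_mul_distrib]
    exact Finset.prod_congr rfl fun j _ => by ring
  have h6 : ∏ j, (1 - u j * u j) = (∏ j, (1 - u j)) * ∏ j, (1 + u j) := by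
    rw [← h5]
    exact Finset.prod_congr rfl fun j _ => by ring
  rw [h5, h6]
  congr 1
  field_simp

/-- At second order the pair product contributes `-∑_{i<j} u_i u_j` and the even part `+∑_{i<j} u_i
u_j`, while `p` is removed by `(1 + p)⁻¹`. Everything left is of size `t ^ 4`. -/
theorem exists_localFactor_bound (k : ℕ) :
    ∃ C : ℝ, ∀ (u : Fin k → ℂ) (p t : ℝ), 0 ≤ t → t ≤ 1 → (∀ j, ‖u j‖ ≤ t) → 0 ≤ p → p ≤ t ^ 2 →
      ‖localFactor u p - 1‖ ≤ C * t ^ 4 := by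
  -- A big-O along the principal filter of `S` is a bound uniform on `S`.
  let S : Set ((Fin k → ℂ) × ℝ × ℝ) := {x | 0 ≤ x.2.2 ∧ x.2.2 ≤ 1 ∧ (∀ j, ‖x.1 j‖ ≤ x.2.2) ∧
    0 ≤ x.2.1 ∧ x.2.1 ≤ x.2.2 ^ 2}
  let t : (Fin k → ℂ) × ℝ × ℝ → ℝ := fun x => x.2.2
  have ht : t =O[𝓟 S] fun _ => (1 : ℝ) := by
    refine isBigO_principal.2 ⟨1, fun x hx => ?_⟩
    simpa [t, abs_of_nonneg hx.1] using hx.2.1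
  have hu (j : Fin k) : (fun x : (Fin k → ℂ) × ℝ × ℝ => x.1 j) =O[𝓟 S] t := by
    refine isBigO_principal.2 ⟨1, fun x hx => ?_⟩
    simpa [t, abs_of_nonneg hx.1] using hx.2.2.1 j
  have hp : (fun x : (Fin k → ℂ) × ℝ × ℝ => (x.2.1 : ℂ)) =O[𝓟 S] fun x => t x ^ 2 := by
    refine isBigO_principal.2 ⟨1, fun x hx => ?_⟩
    simpa [t, abs_of_nonneg hx.2.2.2.1] using hx.2.2.2.2
  have hp1 : (fun x : (Fin k → ℂ) × ℝ × ℝ => (1 + (x.2.1 : ℂ))⁻¹) =O[𝓟 S] fun _ => (1 : ℝ) := by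
    refine isBigO_principal.2 ⟨1, fun x hx => ?_⟩
    have h0 := hx.2.2.2.1
    rw [norm_inv, show (1 + (x.2.1 : ℂ)) = ((1 + x.2.1 : ℝ) : ℂ) by push_cast; rfl,
      Complex.norm_real, Real.norm_of_nonneg (by linarith)]
    simpa using inv_le_one_of_one_le₀ (by linarith : (1 : ℝ) ≤ 1 + x.2.1)
  have ht2 : (fun x => t x ^ 2) =O[𝓟 S] fun _ => (1 : ℝ) := by simpa using ht.pow 2
  have hone : (fun _ : (Fin k → ℂ) × ℝ × ℝ => (1 : ℂ)) =O[𝓟 S] fun _ => (1 : ℝ) :=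
    isBigO_const_const _ one_ne_zero _
  obtain ⟨hP1, hP2⟩ := isBigO_prod_one_sub ht2
    (Finset.univ.sigma fun i : Fin k => Finset.Ioi i)
    (y := fun ij x => x.1 ij.1 * x.1 ij.2)
    (fun ij _ => ((hu ij.1).mul (hu ij.2)).congr_right fun x => by ring)
  obtain ⟨hD, -⟩ := isBigO_prod_one_sub ht2 (Finset.univ : Finset (Fin k))
    (y := fun i x => x.1 i ^ 2) (fun i _ => (hu i).pow 2)
  have hE := isBigO_even_part ht (Finset.univ : Finset (Fin k)) fun i _ => hu i
  have he2 : (fun x : (Fin k → ℂ) × ℝ × ℝ => ∑ ij ∈ Finset.univ.sigma fun i : Fin k =>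
      Finset.Ioi i, x.1 ij.1 * x.1 ij.2) =O[𝓟 S] fun x => t x ^ 2 :=
    IsBigO.fun_sum fun ij _ => ((hu ij.1).mul (hu ij.2)).congr_right fun x => by ring
  have hPp := (hP1.trans ht2).add hone
  have hDp := (hD.trans ht2).add hone
  -- With `R` the pair product, `E` the even part, `D = ∏ (1 - u_j²)` and `e` the pair sum: `RE - 1
  -- = (R - 1 + e) + (R - 1)e + R(E - 1 - e)`, and the `p`-terms give `p((R - 1)D + (D - 1))`.
  have key := ((((hP2.add (hP1.mul he2)).congr_right fun x => (by ring : _ = t x ^ 4)).add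
    ((hPp.mul hE).congr_right fun x => one_mul _)).add
    ((hp.mul (((hP1.mul hDp).congr_right fun x => mul_one _).add hD)).congr_right
      fun x => (by ring : _ = t x ^ 4))).mul hp1
  obtain ⟨C, hC⟩ := isBigO_principal.1 key
  refine ⟨C, fun u p s hs0 hs1 hus hp0 hps => ?_⟩
  have := hC (u, p, s) ⟨hs0, hs1, hus, hp0, hps⟩
  rw [mul_one, Real.norm_of_nonneg (pow_nonneg hs0 4)] at this
  refine (congrArg norm ?_).le.trans this
  have h1p : (1 : ℂ) + p ≠ 0 := by
    rw [← Complex.ofReal_one, ← Complex.ofReal_add, Complex.ofReal_ne_zero]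
    linarith
  rw [localFactor, ← sum_sum_Ioi_mul, Finset.prod_sigma, Finset.sum_sigma]
  field_simp
  ring

end LocalFactor

/-! ### Convergence, holomorphy and nonvanishing of the Euler product -/

section EulerProduct

variable (F : Type*) [Field F] [Fintype F]

theorem one_lt_q : 1 < q F := Fintype.one_lt_card

theorem q_cast_ne_zero : (q F : ℂ) ≠ 0 := by
  have := one_lt_q F
  exact_mod_cast (by omega : q F ≠ 0)

variable {F} in
theorem one_lt_polyNorm (P : PrimePoly F) : 1 < polyNorm P.1 := by
  rw [polyNorm, if_neg P.2.1.ne_zero]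
  exact one_lt_pow₀ (by exact_mod_cast one_lt_q F) P.2.2.natDegree_pos.ne'

theorem summable_polyNorm_rpow {s : ℝ} (hs : 1 < s) :
    Summable fun P : PrimePoly F => polyNorm P.1 ^ (-s) := by
  have h := (hasSum_zetaA (F := F) (s := (s : ℂ)) (by simpa using hs)).summable.norm
  have hinj : Function.Injective
      (fun P : PrimePoly F => (⟨P.1, P.2.1⟩ : {f : F[X] // f.Monic})) := by
    intro P Q h
    exact Subtype.ext (congrArg (fun f => f.1) h)
  refine (h.comp_injective hinj).congr fun P => ?_
  have hP : 0 < polyNorm P.1 := one_pos.trans (one_lt_polyNorm P)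
  simp only [Function.comp_apply]
  rw [Complex.norm_cpow_eq_rpow_re_of_pos hP]
  simp

/-- The factor of the Euler product at a prime of norm `N`. -/
def eulerFactor (N : ℝ) {k : ℕ} (z : Fin k → ℂ) : ℂ :=
  localFactor (fun j => 1 / (N : ℂ) ^ (1 / 2 + z j)) (1 / N)

theorem norm_one_div_cpow_le {N r : ℝ} (hN : 1 < N) {z : ℂ} (hz : ‖z‖ ≤ r) :
    ‖1 / (N : ℂ) ^ (1 / 2 + z)‖ ≤ N ^ (-(1 / 2) + r) := by
  rw [one_div, ← Complex.cpow_neg, Complex.norm_cpow_eq_rpow_re_of_pos (by linarith)]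
  refine Real.rpow_le_rpow_of_exponent_le hN.le ?_
  have h1 := (abs_le.1 (Complex.abs_re_le_norm z)).1
  have h2 : (-(1 / 2 + z)).re = -(1 / 2) - z.re := by
    simp
    ring
  rw [h2]
  linarith

theorem eulerFactor_eq {N r : ℝ} (hN : 1 < N) (hr : r < 1 / 2) {k : ℕ} {z : Fin k → ℂ}
    (hz : ∀ j, ‖z j‖ ≤ r) :
    (∏ i, ∏ j ∈ Finset.Ici i, (1 - 1 / (N : ℂ) ^ (1 + z i + z j)))
      * (1 / 2 * ((∏ j, (1 - 1 / (N : ℂ) ^ (1 / 2 + z j))⁻¹)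
          + ∏ j, (1 + 1 / (N : ℂ) ^ (1 / 2 + z j))⁻¹) + 1 / (N : ℂ)) * (1 + 1 / (N : ℂ))⁻¹
      = eulerFactor N z := by
  have hN0 : (N : ℂ) ≠ 0 := by exact_mod_cast (by linarith : N ≠ 0)
  have hlt (j : Fin k) : ‖1 / (N : ℂ) ^ (1 / 2 + z j)‖ < 1 :=
    (norm_one_div_cpow_le hN (hz j)).trans_lt
      (Real.rpow_lt_one_of_one_lt_of_neg hN (by linarith))
  rw [eulerFactor, ← localFactor_eq]
  · congr 3
    ext i
    refine Finset.prod_congr rfl fun j _ => ?_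
    rw [show 1 + z i + z j = (1 / 2 + z i) + (1 / 2 + z j) by ring, Complex.cpow_add _ _ hN0]
    ring
  · intro j h
    have h1 := hlt j
    rw [← sub_eq_zero.1 h] at h1
    simp at h1
  · intro j h
    have h1 := hlt j
    rw [← neg_eq_of_add_eq_zero_right h] at h1
    simp at h1

theorem exists_eulerFactor_bound (k : ℕ) {r : ℝ} (hr0 : 0 ≤ r) (hr : r < 1 / 2) :
    ∃ C : ℝ, ∀ (N : ℝ) (z : Fin k → ℂ), 1 < N → (∀ j, ‖z j‖ ≤ r) →
      ‖eulerFactor N z - 1‖ ≤ C * N ^ (-(2 - 4 * r)) := by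
  obtain ⟨C, hC⟩ := exists_localFactor_bound k
  refine ⟨C, fun N z hN hz => ?_⟩
  have hN0 : 0 ≤ N := by linarith
  have h := hC (fun j => 1 / (N : ℂ) ^ (1 / 2 + z j)) (1 / N) (N ^ (-(1 / 2) + r))
    (Real.rpow_nonneg hN0 _) (Real.rpow_le_one_of_one_le_of_nonpos hN.le (by linarith))
    (fun j => norm_one_div_cpow_le hN (hz j)) (by positivity) (by
      rw [← Real.rpow_natCast, ← Real.rpow_mul hN0, one_div, ← Real.rpow_neg_one]
      refine Real.rpow_le_rpow_of_exponent_le hN.le ?_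
      push_cast
      linarith)
  rw [← Real.rpow_natCast, ← Real.rpow_mul hN0,
    show (-(1 / 2) + r) * ((4 : ℕ) : ℝ) = -(2 - 4 * r) by push_cast; ring] at h
  simpa [eulerFactor] using h

theorem continuous_eulerFactor {N : ℝ} (hN : 1 < N) (k : ℕ) :
    Continuous (eulerFactor N : (Fin k → ℂ) → ℂ) := by
  have hN0 : (N : ℂ) ≠ 0 := by exact_mod_cast (by linarith : N ≠ 0)
  have h (j : Fin k) : Continuous fun z : Fin k → ℂ => 1 / (N : ℂ) ^ (1 / 2 + z j) := by
    simp only [one_div, ← Complex.cpow_neg]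
    exact (continuous_const.add (continuous_apply j)).neg.const_cpow (Or.inl hN0)
  unfold eulerFactor localFactor
  fun_prop

theorem differentiable_eulerFactor {N : ℝ} (hN : 1 < N) (k : ℕ) :
    Differentiable ℂ (eulerFactor N : (Fin k → ℂ) → ℂ) := by
  have hN0 : (N : ℂ) ≠ 0 := by exact_mod_cast (by linarith : N ≠ 0)
  have h (j : Fin k) : Differentiable ℂ fun z : Fin k → ℂ => 1 / (N : ℂ) ^ (1 / 2 + z j) := by
    simp only [one_div, ← Complex.cpow_neg]
    exact ((differentiable_const _).add (differentiable_apply j)).neg.const_cpow (Or.inl hN0)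
  unfold eulerFactor localFactor
  fun_prop

theorem eulerA_eq_tprod {r : ℝ} (hr : r < 1 / 2) {k : ℕ} {z : Fin k → ℂ}
    (hz : ∀ j, ‖z j‖ ≤ r) :
    eulerA F z = ∏' P : PrimePoly F, (1 + (eulerFactor (polyNorm P.1) z - 1)) := by
  refine tprod_congr fun P => ?_
  rw [add_sub_cancel, ← eulerFactor_eq (one_lt_polyNorm P) hr hz]

/-- Here `r < 1/4` is decisive: it makes the exponent `2 - 4r` exceed `1`. -/
theorem exists_summable_eulerFactor_bound (k : ℕ) {r : ℝ} (hr0 : 0 ≤ r) (hr : r < 1 / 4) :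
    ∃ b : PrimePoly F → ℝ, Summable b ∧ ∀ P (z : Fin k → ℂ), (∀ j, ‖z j‖ ≤ r) →
      ‖eulerFactor (polyNorm P.1) z - 1‖ ≤ b P := by
  obtain ⟨C, hC⟩ := exists_eulerFactor_bound k hr0 (hr.trans (by norm_num))
  exact ⟨_, (summable_polyNorm_rpow F (by linarith : 1 < 2 - 4 * r)).mul_left C,
    fun P z hz => hC _ z (one_lt_polyNorm P) hz⟩

theorem continuousOn_eulerA (k : ℕ) {r : ℝ} (hr0 : 0 ≤ r) (hr : r < 1 / 4) :
    ContinuousOn (eulerA F : (Fin k → ℂ) → ℂ) {z | ∀ j, ‖z j‖ ≤ r} := by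
  obtain ⟨b, hb, h⟩ := exists_summable_eulerFactor_bound F k hr0 hr
  have hK : IsCompact {z : Fin k → ℂ | ∀ j, ‖z j‖ ≤ r} := by
    have e : {z : Fin k → ℂ | ∀ j, ‖z j‖ ≤ r} = Metric.closedBall 0 r := by
      ext z
      simp [pi_norm_le_iff_of_nonneg hr0]
    rw [e]
    exact isCompact_closedBall _ _
  have hu := Summable.hasProdUniformlyOn_one_add hK hb
    (Eventually.of_forall fun P z hz => h P z hz)
    (fun P => ((continuous_eulerFactor (one_lt_polyNorm P) k).sub continuous_const).continuousOn)
  have hcont := (hasProdUniformlyOn_iff_tendstoUniformlyOn.1 hu).continuousOn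
    (Eventually.frequently (Eventually.of_forall fun s => by
      refine Continuous.continuousOn (continuous_finsetProd _ fun P _ => ?_)
      exact continuous_const.add
        ((continuous_eulerFactor (one_lt_polyNorm P) k).sub continuous_const)))
  exact hcont.congr fun z hz => eulerA_eq_tprod F (hr.trans (by norm_num)) hz

/-- Holomorphy in each variable separately is all that the change of radius requires. -/
theorem differentiableOn_eulerA_update (k : ℕ) {r : ℝ} (hr0 : 0 ≤ r) (hr : r < 1 / 4)
    {z : Fin k → ℂ} (hz : ∀ j, ‖z j‖ ≤ r) (j : Fin k) :
    DifferentiableOn ℂ (fun w => eulerA F (Function.update z j w)) {w | ‖w‖ < r} := by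
  obtain ⟨b, hb, h⟩ := exists_summable_eulerFactor_bound F k hr0 hr
  have hO : IsOpen {w : ℂ | ‖w‖ < r} := isOpen_lt continuous_norm continuous_const
  have hmem {w : ℂ} (hw : ‖w‖ < r) (i : Fin k) : ‖Function.update z j w i‖ ≤ r := by
    rcases eq_or_ne i j with rfl | hij
    · simpa using hw.le
    · simpa [hij] using hz i
  have hdiff (P : PrimePoly F) :
      Differentiable ℂ fun w => eulerFactor (polyNorm P.1) (Function.update z j w) - 1 :=
    ((differentiable_eulerFactor (one_lt_polyNorm P) k).comp
      (fun w => (hasFDerivAt_update z w).differentiableAt)).sub_const 1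
  have hu := Summable.hasProdLocallyUniformlyOn_one_add hO hb
    (Eventually.of_forall fun P w hw => h P _ (hmem hw))
    (fun P => (hdiff P).continuous.continuousOn)
  have hd := (hasProdLocallyUniformlyOn_iff_tendstoLocallyUniformlyOn.1 hu).differentiableOn
    (Eventually.of_forall fun s => by
      refine Differentiable.differentiableOn (Differentiable.fun_finsetProd fun P _ => ?_)
      exact (hdiff P).const_add 1) hO
  exact hd.congr fun w hw => eulerA_eq_tprod F (hr.trans (by norm_num)) (hmem hw)

/-- At the origin `u_j = N^{-1/2}` lies in `(0, 1)`, so the factor is a positive real number. -/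
theorem eulerFactor_zero_ne_zero {N : ℝ} (hN : 1 < N) (k : ℕ) :
    eulerFactor N (fun _ : Fin k => 0) ≠ 0 := by
  set u : ℝ := N ^ (-(1 / 2) : ℝ) with hu
  have hu0 : 0 < u := Real.rpow_pos_of_pos (by linarith) _
  have hu1 : u < 1 := Real.rpow_lt_one_of_one_lt_of_neg hN (by norm_num)
  have huc : 1 / (N : ℂ) ^ (1 / 2 + 0 : ℂ) = (u : ℂ) := by
    rw [hu, Complex.ofReal_cpow (by linarith), one_div, ← Complex.cpow_neg]
    congr 1
    push_cast
    ring
  have hreal : eulerFactor N (fun _ : Fin k => 0)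
      = (((∏ i : Fin k, ∏ j ∈ Finset.Ioi i, (1 - u * u))
        * (1 / 2 * (∏ j : Fin k, (1 + u) + ∏ j : Fin k, (1 - u))
          + 1 / N * ∏ j : Fin k, (1 - u ^ 2)) * (1 + 1 / N)⁻¹ : ℝ) : ℂ) := by
    simp only [eulerFactor, localFactor, huc]
    push_cast
    rfl
  rw [hreal, Complex.ofReal_ne_zero]
  have h1 : 0 < 1 - u := by linarith
  have h2 : 0 < 1 - u * u := by nlinarith
  have h3 : 0 < 1 - u ^ 2 := by nlinarith
  have hN0 : 0 < N := by linarith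
  have h4 : 0 < ∏ i : Fin k, ∏ j ∈ Finset.Ioi i, (1 - u * u) :=
    Finset.prod_pos fun i _ => Finset.prod_pos fun j _ => h2
  have h5 : 0 < ∏ j : Fin k, (1 - u) := Finset.prod_pos fun j _ => h1
  have h6 : 0 < ∏ j : Fin k, (1 - u ^ 2) := Finset.prod_pos fun j _ => h3
  positivity

theorem eulerA_zero_ne_zero (k : ℕ) : eulerA F (fun _ : Fin k => (0 : ℂ)) ≠ 0 := by
  obtain ⟨b, hb, h⟩ := exists_summable_eulerFactor_bound F k le_rfl (by norm_num : (0 : ℝ) < 1 / 4)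
  have hz : ∀ j : Fin k, ‖(fun _ : Fin k => (0 : ℂ)) j‖ ≤ 0 := by simp
  rw [eulerA_eq_tprod F (by norm_num : (0 : ℝ) < 1 / 2) hz]
  refine tprod_one_add_ne_zero_of_summable (fun P => ?_)
    (hb.of_nonneg_of_le (fun _ => norm_nonneg _) fun P => h P _ hz)
  rw [add_sub_cancel]
  exact eulerFactor_zero_ne_zero (one_lt_polyNorm P) k

end EulerProduct

/-! ### Counting square-free polynomials -/

section Counting

variable {F : Type*} [Field F]

theorem exists_squarefree_mul_sq {f : F[X]} (hf : f.Monic) :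
    ∃ a b : F[X], a.Monic ∧ b.Monic ∧ Squarefree a ∧ f = a * b ^ 2 := by
  classical
  induction h : f.natDegree using Nat.strong_induction_on generalizing f with
  | _ n ih =>
    by_cases hs : Squarefree f
    · exact ⟨f, 1, hf, monic_one, hs, by simp⟩
    · simp only [Squarefree, not_forall] at hs
      obtain ⟨x, ⟨c, hc⟩, hx⟩ := hs
      have hx0 : x ≠ 0 := by
        rintro rfl
        simp [hf.ne_zero] at hc
      have hy : (normalize x).Monic := Polynomial.monic_normalize hx0
      have hyd : 0 < (normalize x).natDegree := by
        rw [hy.natDegree_pos]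
        intro h1
        exact hx (normalize_eq_one.1 h1)
      obtain ⟨d, hd⟩ : (normalize x) ^ 2 ∣ f :=
        (((normalize_associated x).pow_pow (n := 2)).dvd.trans ⟨c, by rw [hc, sq]⟩)
      have hdm : d.Monic := (hy.pow 2).of_mul_monic_left (hd ▸ hf)
      have hdeg : d.natDegree < n := by
        have := (hy.pow 2).natDegree_mul hdm
        rw [← hd, h, hy.natDegree_pow] at this
        omega
      obtain ⟨a, b, ha, hb, has, hab⟩ := ih _ hdeg hdm rfl
      exact ⟨a, normalize x * b, ha, hy.mul hb, has, by rw [hd, hab]; ring⟩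

/-- This gives uniqueness of `f = a b²`. After division by the gcd `g`, `(b/g)²` is coprime to
`(b'/g)²` and hence divides the square-free `a'`, so `b/g` is a unit. -/
theorem dvd_of_squarefree_mul_sq_eq {a b a' b' : F[X]} (hb : b ≠ 0) (ha' : Squarefree a')
    (h : a * b ^ 2 = a' * b' ^ 2) : b ∣ b' := by
  classical
  set g := EuclideanDomain.gcd b b' with hgdef
  have hg : g ≠ 0 := fun h0 => hb (EuclideanDomain.gcd_eq_zero_iff.1 h0).1
  have e1 : b = g * (b / g) := (EuclideanDomain.mul_div_cancel' hg
    (EuclideanDomain.gcd_dvd_left b b')).symm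
  have e2 : b' = g * (b' / g) := (EuclideanDomain.mul_div_cancel' hg
    (EuclideanDomain.gcd_dvd_right b b')).symm
  have hco : IsCoprime (b / g) (b' / g) := by
    refine ⟨EuclideanDomain.gcdA b b', EuclideanDomain.gcdB b b', mul_left_cancel₀ hg ?_⟩
    calc _ = g * (b / g) * EuclideanDomain.gcdA b b'
          + g * (b' / g) * EuclideanDomain.gcdB b b' := by ring
      _ = g * 1 := by rw [← e1, ← e2, ← EuclideanDomain.gcd_eq_gcd_ab, mul_one]
  have h1 : a * (b / g) ^ 2 = a' * (b' / g) ^ 2 := by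
    refine mul_left_cancel₀ (pow_ne_zero 2 hg) ?_
    calc _ = a * (g * (b / g)) ^ 2 := by ring
      _ = a' * (g * (b' / g)) ^ 2 := by rw [← e1, ← e2, h]
      _ = _ := by ring
  have h2 : (b / g) ^ 2 ∣ a' := (hco.pow (m := 2) (n := 2)).dvd_of_dvd_mul_right ⟨a, by
    rw [← h1]; ring⟩
  have h3 : IsUnit (b / g) := ha' _ (by rwa [← sq])
  rw [e1]
  exact h3.mul_right_dvd.2 (EuclideanDomain.gcd_dvd_right b b')

variable [Fintype F]

theorem mem_ensemble {n : ℕ} {f : F[X]} :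
    f ∈ ensemble F n ↔ (f.Monic ∧ f.natDegree = n) ∧ Squarefree f := by
  simp [ensemble, mem_monics]

/-- Every monic `f` is uniquely `a b²` with `a` square-free and both monic; `m` is the degree of
`b`. -/
theorem sum_card_ensemble (n : ℕ) :
    ∑ m ∈ Finset.range (n / 2 + 1), (ensemble F (n - 2 * m)).card * q F ^ m = q F ^ n := by
  have h1 : ∑ m ∈ Finset.range (n / 2 + 1), (ensemble F (n - 2 * m)).card * q F ^ m
      = ((Finset.range (n / 2 + 1)).sigma
        fun m => ensemble F (n - 2 * m) ×ˢ monics F m).card := by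
    simp only [Finset.card_sigma, Finset.card_product, card_monics]
  rw [h1, ← card_monics]
  refine Finset.card_bij (fun x _ => x.2.1 * x.2.2 ^ 2) ?_ ?_ ?_
  · rintro ⟨m, a, b⟩ hx
    simp only [Finset.mem_sigma, Finset.mem_range, Finset.mem_product, mem_ensemble,
      mem_monics] at hx ⊢
    obtain ⟨hm, ⟨⟨ha, had⟩, -⟩, hb, hbd⟩ := hx
    refine ⟨ha.mul (hb.pow 2), ?_⟩
    rw [ha.natDegree_mul (hb.pow 2), hb.natDegree_pow]
    omega
  · rintro ⟨m, a, b⟩ hx ⟨m', a', b'⟩ hx' h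
    simp only [Finset.mem_sigma, Finset.mem_range, Finset.mem_product, mem_ensemble,
      mem_monics] at hx hx' h
    obtain ⟨-, ⟨-, has⟩, hb, rfl⟩ := hx
    obtain ⟨-, ⟨-, has'⟩, hb', rfl⟩ := hx'
    obtain rfl : b = b' := eq_of_monic_of_associated hb hb' (associated_of_dvd_dvd
      (dvd_of_squarefree_mul_sq_eq hb.ne_zero has' h)
      (dvd_of_squarefree_mul_sq_eq hb'.ne_zero has h.symm))
    obtain rfl : a = a' := mul_right_cancel₀ (pow_ne_zero 2 hb.ne_zero) h
    rfl
  · intro f hf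
    rw [mem_monics] at hf
    obtain ⟨a, b, ha, hb, has, rfl⟩ := exists_squarefree_mul_sq hf.1
    have hdeg := hf.2
    rw [ha.natDegree_mul (hb.pow 2), hb.natDegree_pow] at hdeg
    refine ⟨⟨b.natDegree, a, b⟩, ?_, rfl⟩
    simp only [Finset.mem_sigma, Finset.mem_range, Finset.mem_product, mem_ensemble, mem_monics]
    exact ⟨by omega, ⟨⟨ha, by omega⟩, has⟩, hb, trivial⟩

/-- The number of monic square-free polynomials of degree `n + 2` is `q^{n+2} - q^{n+1}`. -/
theorem card_ensemble_add (n : ℕ) :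
    (ensemble F (n + 2)).card + q F ^ (n + 1) = q F ^ (n + 2) := by
  have h := sum_card_ensemble (F := F) (n + 2)
  rw [show (n + 2) / 2 + 1 = (n / 2 + 1) + 1 by omega, Finset.sum_range_succ'] at h
  -- The terms with `deg b ≥ 1` are `q` times the same identity in degree `n`.
  have h2 : ∑ m ∈ Finset.range (n / 2 + 1), (ensemble F (n + 2 - 2 * (m + 1))).card * q F ^ (m + 1)
      = q F ^ (n + 1) := by
    rw [pow_succ, ← sum_card_ensemble (F := F) n, Finset.sum_mul]
    refine Finset.sum_congr rfl fun m _ => ?_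
    rw [show n + 2 - 2 * (m + 1) = n - 2 * m by omega]
    ring
  rw [h2] at h
  simpa [add_comm] using h

theorem card_ensemble {n : ℕ} (hn : 2 ≤ n) :
    ((ensemble F n).card : ℂ) = (q F : ℂ) ^ n / zetaA F 2 := by
  obtain ⟨n, rfl⟩ := Nat.exists_eq_add_of_le' hn
  have h : ((ensemble F (n + 2)).card : ℂ) + (q F : ℂ) ^ (n + 1) = (q F : ℂ) ^ (n + 2) := by
    exact_mod_cast card_ensemble_add (F := F) n
  have hq := q_cast_ne_zero F
  rw [zetaA, show (1 - 2 : ℂ) = -1 by norm_num, Complex.cpow_neg_one, one_div, div_inv_eq_mul,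
    eq_sub_of_add_eq h]
  field_simp
  ring

end Counting

/-! ### Factoring the integrand and rescaling -/

section Integrand

variable (F : Type*) [Field F] [Fintype F]

theorem log_q_pos : 0 < Real.log (q F) := Real.log_pos (by exact_mod_cast one_lt_q F)

/-- The holomorphic function `s ζ_A(1 + s)` near `s = 0`. -/
def zetaReg (s : ℂ) : ℂ := (dslope (fun s => 1 - (q F : ℂ) ^ (-s)) 0 s)⁻¹

theorem zetaA_one_add (s : ℂ) : zetaA F (1 + s) = zetaReg F s * s⁻¹ := by
  rcases eq_or_ne s 0 with rfl | hs
  -- At the pole both sides are `0`, since division by zero gives `0`; the factorization thus needs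
  -- no hypothesis on `s`.
  · simp [zetaA]
  · rw [zetaA, zetaReg, dslope_of_ne _ hs, slope_def_field]
    have hq := q_cast_ne_zero F
    simp only [neg_zero, Complex.cpow_zero, sub_self, sub_zero, inv_div, one_div]
    rw [show 1 - (1 + s) = -s by ring]
    field_simp

theorem q_cpow (s : ℂ) : (q F : ℂ) ^ s = Complex.exp (Real.log (q F) * s) := by
  rw [Complex.cpow_def_of_ne_zero (q_cast_ne_zero F), Complex.natCast_log]

theorem hasDerivAt_one_sub_q_cpow_neg (s : ℂ) :
    HasDerivAt (fun s => 1 - (q F : ℂ) ^ (-s)) (Real.log (q F) * (q F : ℂ) ^ (-s)) s := by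
  simp only [q_cpow]
  have h : HasDerivAt (fun s : ℂ => 1 - Complex.exp (Real.log (q F) * -s))
      (-(Complex.exp (Real.log (q F) * -s) * (Real.log (q F) * -1))) s :=
    (((hasDerivAt_neg s).const_mul _).cexp).const_sub 1
  exact h.congr_deriv (by ring)

theorem zetaReg_zero : zetaReg F 0 = (Real.log (q F) : ℂ)⁻¹ := by
  rw [zetaReg, dslope_same, (hasDerivAt_one_sub_q_cpow_neg F 0).deriv]
  simp

/-- The zeros of `1 - q^{-s}` are the multiples of `2πi / log q`, and the one at `0` is removed by
the slope. For `s = z_i + z_j` the bound follows from `‖z_j‖ < π / log q`. -/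
theorem differentiableAt_zetaReg {s : ℂ} (hs : ‖s‖ < 2 * (π / Real.log (q F))) :
    DifferentiableAt ℂ (zetaReg F) s := by
  have hlog := log_q_pos F
  have hd : DifferentiableOn ℂ (dslope (fun s : ℂ => 1 - (q F : ℂ) ^ (-s)) 0) Set.univ := by
    rw [Complex.differentiableOn_dslope univ_mem]
    exact fun s _ => (hasDerivAt_one_sub_q_cpow_neg F s).differentiableAt.differentiableWithinAt
  refine ((hd s (Set.mem_univ s)).differentiableAt univ_mem).inv ?_
  rcases eq_or_ne s 0 with rfl | hs0
  · rw [dslope_same, (hasDerivAt_one_sub_q_cpow_neg F 0).deriv]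
    have : (Real.log (q F) : ℂ) ≠ 0 := Complex.ofReal_ne_zero.2 hlog.ne'
    simpa using this
  · rw [dslope_of_ne _ hs0, slope_def_field]
    refine div_ne_zero (fun h => ?_) (by simpa using hs0)
    have h1 : Complex.exp (Real.log (q F) * (-s)) = 1 := by
      rw [← q_cpow]
      have h0 : 1 - (q F : ℂ) ^ (-s) = 0 := by simpa using h
      exact (sub_eq_zero.1 h0).symm
    obtain ⟨n, hn⟩ := Complex.exp_eq_one_iff.1 h1
    have h2 : Real.log (q F) * ‖s‖ = |(n : ℝ)| * (2 * π) := by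
      have := congrArg norm hn
      rw [norm_mul, Complex.norm_real, Real.norm_of_nonneg hlog.le, norm_neg] at this
      simpa [abs_of_pos Real.pi_pos] using this
    have h3 : Real.log (q F) * ‖s‖ < 2 * π := by
      calc _ < Real.log (q F) * (2 * (π / Real.log (q F))) := by gcongr
        _ = _ := by field_simp
    have h4 : |(n : ℝ)| < 1 := by
      have := Real.pi_pos
      rw [h2] at h3
      nlinarith
    have h5 : n = 0 := by
      rw [← Int.abs_lt_one_iff]
      exact_mod_cast h4
    rw [h5] at h2
    have h6 : 0 < ‖s‖ := norm_pos_iff.2 hs0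
    simp [hlog.ne', hs0] at h2

/-- The bound on `z` keeps the imaginary part of `z log q` inside `(-π, π)`, where the principal
logarithm inverts `exp`. -/
theorem Xfactor_cpow {z : ℂ} (hz : ‖z‖ < π / Real.log (q F)) :
    (Xfactor F (1 / 2 + z)) ^ (-(1 / 2) : ℂ) = Complex.exp (-(Real.log (q F) * z) / 2) := by
  have hlog := log_q_pos F
  have him : |(Real.log (q F) * z : ℂ).im| < π := by
    rw [Complex.im_ofReal_mul, abs_mul, abs_of_pos hlog]
    calc _ ≤ Real.log (q F) * ‖z‖ := by gcongr; exact Complex.abs_im_le_norm z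
      _ < Real.log (q F) * (π / Real.log (q F)) := by gcongr
      _ = π := by field_simp
  rw [Xfactor, show -(1 / 2) + (1 / 2 + z) = z by ring, q_cpow,
    Complex.cpow_def_of_ne_zero (Complex.exp_ne_zero _),
    Complex.log_exp (abs_lt.1 him).1 (abs_lt.1 him).2.le]
  congr 1
  ring

/-- The part of `G` that is holomorphic near `0`. -/
def regularPart {k : ℕ} (z : Fin k → ℂ) : ℂ :=
  eulerA F z * (∏ j, Complex.exp (-(Real.log (q F) * z j) / 2))
    * ∏ i, ∏ j ∈ Finset.Ici i, zetaReg F (z i + z j)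

theorem mul_succ_div_two (k : ℕ) : k * (k + 1) / 2 = k + k * (k - 1) / 2 := by
  rcases k with - | k
  · rfl
  · rw [show (k + 1) * (k + 1 + 1) = (k + 1) * (k + 1 - 1) + (k + 1) * 2 by simp; ring,
      Nat.add_mul_div_right _ _ two_pos, add_comm]

theorem regularPart_zero (k : ℕ) :
    regularPart F (fun _ : Fin k => (0 : ℂ))
      = eulerA F (fun _ : Fin k => (0 : ℂ)) * ((Real.log (q F) : ℂ)⁻¹) ^ (k * (k + 1) / 2) := by
  simp only [regularPart, ← Finset.mul_prod_Ioi_eq_prod_Ici, Finset.prod_mul_distrib, add_zero,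
    zetaReg_zero, prod_prod_Ioi_const, mul_succ_div_two, pow_add]
  simp

theorem continuousOn_regularPart (k : ℕ) {r : ℝ} (hr0 : 0 ≤ r) (hr1 : r < 1 / 4)
    (hr2 : r < π / Real.log (q F)) :
    ContinuousOn (regularPart F : (Fin k → ℂ) → ℂ) {z | ∀ j, ‖z j‖ ≤ r} := by
  refine ((continuousOn_eulerA F k hr0 hr1).mul (Continuous.continuousOn (by fun_prop))).mul ?_
  refine continuousOn_finsetProd _ fun i _ => continuousOn_finsetProd _ fun j _ => ?_
  intro z hz
  refine ContinuousAt.continuousWithinAt ?_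
  have h : ‖z i + z j‖ < 2 * (π / Real.log (q F)) := by
    linarith [norm_add_le (z i) (z j), hz i, hz j]
  exact ContinuousAt.comp (f := fun z : Fin k → ℂ => z i + z j)
    (differentiableAt_zetaReg F h).continuousAt (by fun_prop)

theorem differentiableOn_regularPart_update (k : ℕ) {r : ℝ} (hr0 : 0 ≤ r) (hr1 : r < 1 / 4)
    (hr2 : r < π / Real.log (q F)) {z : Fin k → ℂ} (hz : ∀ j, ‖z j‖ ≤ r) (j : Fin k) :
    DifferentiableOn ℂ (fun w => regularPart F (Function.update z j w)) {w | ‖w‖ < r} := by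
  have hu : Differentiable ℂ (Function.update z j) :=
    fun w => (hasFDerivAt_update z w).differentiableAt
  have hui (i : Fin k) : Differentiable ℂ fun w => Function.update z j w i :=
    differentiable_pi.1 hu i
  have hmem {w : ℂ} (hw : ‖w‖ < r) (i : Fin k) : ‖Function.update z j w i‖ ≤ r := by
    rcases eq_or_ne i j with rfl | hij
    · simpa using hw.le
    · simpa [hij] using hz i
  refine ((differentiableOn_eulerA_update F k hr0 hr1 hz j).mul
    (Differentiable.differentiableOn (by fun_prop))).mul ?_
  intro w hw
  refine DifferentiableAt.differentiableWithinAt ?_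
  refine DifferentiableAt.fun_finsetProd fun i _ => DifferentiableAt.fun_finsetProd fun l _ => ?_
  have h : ‖Function.update z j w i + Function.update z j w l‖ < 2 * (π / Real.log (q F)) := by
    linarith [norm_add_le (Function.update z j w i) (Function.update z j w l), hmem hw i,
      hmem hw l]
  exact DifferentiableAt.comp w (f := fun w => Function.update z j w i + Function.update z j w l)
    (differentiableAt_zetaReg F h) ((hui i).add (hui l) w)

/-- The part of the integrand of `Q_k` that does not depend on `F`. -/
def kernel {k : ℕ} (lam : ℝ) (z : Fin k → ℂ) : ℂ :=
  vandermonde z * vandermonde (fun j => z j ^ 2)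
    * ∏ j, ((z j ^ (2 * k))⁻¹ * Complex.exp (lam * z j))

theorem prod_inv_mul_vandermonde_sq {k : ℕ} (z : Fin k → ℂ) :
    (∏ i, ∏ j ∈ Finset.Ici i, (z i + z j)⁻¹) * vandermonde (fun j => z j ^ 2) ^ 2
      = (2 ^ k)⁻¹ * (∏ i, z i)⁻¹ * (vandermonde z * vandermonde (fun j => z j ^ 2)) := by
  have h : (∏ i, ∏ j ∈ Finset.Ioi i, (z i + z j)⁻¹) * vandermonde (fun j => z j ^ 2) ^ 2
      = vandermonde z * vandermonde (fun j => z j ^ 2) := by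
    simp only [vandermonde, ← Finset.prod_pow, ← Finset.prod_mul_distrib]
    refine Finset.prod_congr rfl fun i _ => Finset.prod_congr rfl fun j _ => ?_
    rw [show z j ^ 2 - z i ^ 2 = (z i + z j) * (z j - z i) by ring]
    -- All circles have the same radius, so the torus meets `z_i + z_j = 0`. There both sides
    -- vanish, the left because `0⁻¹ = 0`, and the identity holds at every point.
    rcases eq_or_ne (z i + z j) 0 with h0 | h0
    · simp [h0]
    · field_simp
  simp only [← Finset.mul_prod_Ioi_eq_prod_Ici, Finset.prod_mul_distrib]
  rw [mul_assoc, h]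
  simp only [← two_mul, mul_inv, Finset.prod_mul_distrib, Finset.prod_inv_distrib,
    Finset.prod_const, Finset.card_univ, Fintype.card_fin]

theorem integrand_eq {k : ℕ} (hk : 1 ≤ k) (x : ℝ) {z : Fin k → ℂ}
    (hz : ∀ j, ‖z j‖ < π / Real.log (q F)) :
    G F z * vandermonde (fun j => z j ^ 2) ^ 2 / (∏ j, z j ^ (2 * k - 1))
        * (q F : ℂ) ^ ((x : ℂ) / 2 * ∑ j, z j)
      = (2 ^ k)⁻¹ * (regularPart F z * kernel (x * Real.log (q F) / 2) z) := by
  have h1 : G F z = regularPart F z * ∏ i, ∏ j ∈ Finset.Ici i, (z i + z j)⁻¹ := by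
    simp only [G, regularPart, Xfactor_cpow F (hz _), add_assoc, zetaA_one_add,
      Finset.prod_mul_distrib]
    ring
  have h2 : (q F : ℂ) ^ ((x : ℂ) / 2 * ∑ j, z j)
      = ∏ j, Complex.exp ((x * Real.log (q F) / 2 : ℝ) * z j) := by
    rw [q_cpow, ← Complex.exp_sum, ← Finset.mul_sum]
    congr 1
    push_cast
    ring
  have h3 : (∏ j, z j)⁻¹ * (∏ j, z j ^ (2 * k - 1))⁻¹ = ∏ j, (z j ^ (2 * k))⁻¹ := by
    rw [← mul_inv, ← Finset.prod_mul_distrib, Finset.prod_inv_distrib]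
    congr 2
    ext j
    rw [← pow_succ', show 2 * k - 1 + 1 = 2 * k by omega]
  have h4 := prod_inv_mul_vandermonde_sq z
  rw [h1, h2, kernel, Finset.prod_mul_distrib, ← h3, div_eq_mul_inv]
  linear_combination (regularPart F z * (∏ j, z j ^ (2 * k - 1))⁻¹
    * ∏ j, Complex.exp ((x * Real.log (q F) / 2 : ℝ) * z j)) * h4

/-- Powers of `λ`: `2k²` from the denominators, minus `k` from the measure, minus `k(k-1)/2` and
`k(k-1)` from the Vandermonde products, leave `k(k+1)/2`. -/
theorem kernel_scale {k : ℕ} {lam : ℝ} (hlam : 0 < lam) (w : Fin k → ℂ) :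
    ((lam⁻¹ : ℝ) : ℂ) ^ k * kernel lam (fun j => ((lam⁻¹ : ℝ) : ℂ) * w j)
      = (lam : ℂ) ^ (k * (k + 1) / 2) * kernel 1 w := by
  have hl : (lam : ℂ) ≠ 0 := by exact_mod_cast hlam.ne'
  have h1 : ∏ j, (((((lam⁻¹ : ℝ) : ℂ) * w j) ^ (2 * k))⁻¹
        * Complex.exp (lam * (((lam⁻¹ : ℝ) : ℂ) * w j)))
      = ((lam : ℂ) ^ (2 * k)) ^ k * ∏ j, ((w j ^ (2 * k))⁻¹ * Complex.exp ((1 : ℝ) * w j)) := by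
    have hc : ((lam : ℂ) ^ (2 * k)) ^ k = ∏ _j : Fin k, (lam : ℂ) ^ (2 * k) := by simp
    rw [hc, ← Finset.prod_mul_distrib]
    refine Finset.prod_congr rfl fun j _ => ?_
    push_cast
    rw [mul_inv_cancel_left₀ hl, one_mul, mul_pow, mul_inv, inv_pow, inv_inv]
    ring
  have h2 : 2 * k * k = k + k * (k - 1) / 2 + 2 * (k * (k - 1) / 2) + k * (k + 1) / 2 := by
    have e1 : k * (k - 1) = 2 * (k * (k - 1) / 2) :=
      (Nat.mul_div_cancel' (Nat.even_mul_pred_self k).two_dvd).symm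
    have e2 : k * (k + 1) = 2 * (k * (k + 1) / 2) :=
      (Nat.mul_div_cancel' (Nat.even_mul_succ_self k).two_dvd).symm
    have e3 : k * (k - 1) + k = k * k := by
      rcases k with - | k
      · rfl
      · simp
        ring
    have e4 : k * (k + 1) = k * k + k := by ring
    have e5 : 2 * k * k = 2 * (k * k) := by ring
    omega
  simp only [kernel]
  rw [h1, ← pow_mul, h2]
  simp only [mul_pow, vandermonde_const_mul]
  simp only [pow_add, pow_mul]
  push_cast
  simp only [inv_pow]
  field_simp

theorem continuous_kernel_torusMap (k : ℕ) (lam : ℝ) {r : ℝ} (hr : 0 < r) :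
    Continuous fun θ : Fin k → ℝ => kernel lam (torusMap 0 (fun _ => r) θ) := by
  have h := continuous_torusMap (fun _ : Fin k => r)
  have hj (j : Fin k) : Continuous fun θ => torusMap 0 (fun _ : Fin k => r) θ j :=
    (continuous_apply j).comp h
  have hne (j : Fin k) (θ : Fin k → ℝ) : torusMap 0 (fun _ : Fin k => r) θ j ≠ 0 := by
    rw [← norm_pos_iff, norm_torusMap_const hr.le]
    exact hr
  unfold kernel vandermonde
  refine Continuous.mul (by fun_prop) (continuous_finsetProd _ fun j _ => ?_)
  exact (((hj j).pow _).inv₀ fun θ => pow_ne_zero _ (hne j θ)).mul (by fun_prop)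

theorem torusIntegral_regularPart_mul_kernel (k : ℕ) {r lam : ℝ} (hr1 : r < 1 / 4)
    (hr2 : r < π / Real.log (q F)) (hlam : 0 < lam) (hle : lam⁻¹ ≤ r) :
    torusIntegral (fun z : Fin k → ℂ => regularPart F z * kernel lam z) (fun _ => 0) (fun _ => r)
      = (lam : ℂ) ^ (k * (k + 1) / 2)
        * torusIntegral (fun w : Fin k → ℂ =>
            regularPart F (fun j => ((lam⁻¹ : ℝ) : ℂ) * w j) * kernel 1 w)
          (fun _ => 0) (fun _ => 1) := by
  have hl0 : 0 < lam⁻¹ := inv_pos.2 hlam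
  have hr0 : 0 < r := hl0.trans_le hle
  rw [torusIntegral_eq_of_differentiableOn_annulus hl0 hle, torusIntegral_scale,
    ← torusIntegral_const_mul, ← torusIntegral_const_mul]
  · congr 1 with w
    linear_combination regularPart F (fun j => ((lam⁻¹ : ℝ) : ℂ) * w j) * kernel_scale hlam w
  · refine ((continuousOn_regularPart F k hr0.le hr1 hr2).mono fun z hz j => (hz j).2).mul ?_
    unfold kernel vandermonde
    refine ContinuousOn.mul (Continuous.continuousOn (by fun_prop))
      (continuousOn_finsetProd _ fun j _ => ?_)
    refine ContinuousOn.mul (ContinuousOn.inv₀ (Continuous.continuousOn (by fun_prop)) ?_)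
      (Continuous.continuousOn (by fun_prop))
    intro z hz
    exact pow_ne_zero _ (norm_pos_iff.1 (hl0.trans_le (hz j).1))
  · intro z hz j
    refine ((differentiableOn_regularPart_update F k hr0.le hr1 hr2 (fun j => (hz j).2) j).mono
      fun w hw => hw.2).mul ?_
    have hu : Differentiable ℂ (Function.update z j) :=
      fun w => (hasFDerivAt_update z w).differentiableAt
    have hui (i : Fin k) : Differentiable ℂ fun w => Function.update z j w i :=
      differentiable_pi.1 hu i
    have hne {w : ℂ} (hw : lam⁻¹ < ‖w‖) (i : Fin k) : Function.update z j w i ≠ 0 := by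
      rcases eq_or_ne i j with rfl | hij
      · simpa using norm_pos_iff.1 (hl0.trans hw)
      · simpa [hij] using norm_pos_iff.1 (hl0.trans_le (hz i).1)
    intro w hw
    refine DifferentiableAt.differentiableWithinAt ?_
    unfold kernel vandermonde
    refine DifferentiableAt.mul (Differentiable.differentiableAt (by fun_prop))
      (DifferentiableAt.fun_finsetProd fun i _ => ?_)
    exact DifferentiableAt.mul ((((hui i) w).pow _).inv (pow_ne_zero _ (hne hw.1 i)))
      (by fun_prop)

/-- Dominated convergence: for large `λ` the argument of `B` is so near `0` that `‖B‖ ≤ ‖B(0)‖ + 1`.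
-/
theorem tendsto_torusIntegral_scaled {k : ℕ} {B K : (Fin k → ℂ) → ℂ} {r : ℝ} (hr : 0 < r)
    (hB : ContinuousOn B {z | ∀ j, ‖z j‖ ≤ r})
    (hK : Continuous fun θ => K (torusMap 0 (fun _ => 1) θ)) :
    Tendsto (fun lam : ℝ => torusIntegral (fun w => B (fun j => ((lam⁻¹ : ℝ) : ℂ) * w j) * K w)
        (fun _ => 0) (fun _ => 1)) atTop
      (𝓝 (B (fun _ => 0) * torusIntegral K (fun _ => 0) (fun _ => 1))) := by
  have hBat : ContinuousAt B (fun _ => 0) := by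
    refine hB.continuousAt (Filter.mem_of_superset (Metric.closedBall_mem_nhds _ hr) ?_)
    intro z hz j
    have := (dist_pi_le_iff hr.le).1 hz j
    simpa using this
  have hscale (w : Fin k → ℂ) :
      Tendsto (fun lam : ℝ => fun j => ((lam⁻¹ : ℝ) : ℂ) * w j) atTop (𝓝 fun _ => 0) := by
    refine tendsto_pi_nhds.2 fun j => ?_
    have h := (Complex.continuous_ofReal.tendsto 0).comp tendsto_inv_atTop_zero
    simpa using h.mul_const (w j)
  obtain ⟨δ, hδ, hBδ⟩ := Metric.continuousAt_iff.1 hBat 1 one_pos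
  have hsmall : ∀ᶠ lam : ℝ in atTop, 0 < lam ∧ lam⁻¹ < δ ∧ lam⁻¹ ≤ r := by
    have h := tendsto_inv_atTop_zero (𝕜 := ℝ)
    filter_upwards [eventually_gt_atTop 0, h.eventually (gt_mem_nhds hδ),
      h.eventually (ge_mem_nhds hr)] with lam h1 h2 h3 using ⟨h1, h2, h3⟩
  have hnorm (θ : Fin k → ℝ) (j : Fin k) : ‖torusMap 0 (fun _ => 1) θ j‖ = 1 :=
    norm_torusMap_const zero_le_one θ j
  rw [← torusIntegral_const_mul]
  unfold torusIntegral
  refine MeasureTheory.tendsto_integral_filter_of_dominated_convergence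
    (fun θ => (‖B (fun _ => 0)‖ + 1) * ‖K (torusMap 0 (fun _ => 1) θ)‖) ?_ ?_ ?_ ?_
  · filter_upwards [hsmall] with lam hlam
    refine Continuous.aestronglyMeasurable ?_
    have hc : Continuous fun θ : Fin k → ℝ =>
        B (fun j => ((lam⁻¹ : ℝ) : ℂ) * torusMap 0 (fun _ => 1) θ j) := by
      refine hB.comp_continuous ?_ fun θ j => ?_
      · have := continuous_torusMap (fun _ : Fin k => 1)
        fun_prop
      · rw [norm_mul, hnorm, mul_one, Complex.norm_real, Real.norm_of_nonneg (inv_pos.2 hlam.1).le]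
        exact hlam.2.2
    simp only [smul_eq_mul]
    exact Continuous.mul (by fun_prop) (hc.mul hK)
  · filter_upwards [hsmall] with lam hlam
    refine Eventually.of_forall fun θ => ?_
    rw [norm_smul, norm_mul]
    have h1 : ‖∏ i : Fin k, (((1 : ℝ) : ℂ) * Complex.exp (θ i * Complex.I) * Complex.I)‖ = 1 := by
      simp [Complex.norm_exp_ofReal_mul_I]
    rw [h1, one_mul]
    refine mul_le_mul_of_nonneg_right ?_ (norm_nonneg _)
    have h2 : dist (fun j => ((lam⁻¹ : ℝ) : ℂ) * torusMap 0 (fun _ => 1) θ j) (fun _ : Fin k => 0)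
        < δ := by
      refine (dist_pi_lt_iff hδ).2 fun j => ?_
      rw [dist_zero_right, norm_mul, hnorm, mul_one, Complex.norm_real,
        Real.norm_of_nonneg (inv_pos.2 hlam.1).le]
      exact hlam.2.1
    have h3 := hBδ h2
    rw [dist_eq_norm] at h3
    have h4 := norm_le_insert' (B (fun j => ((lam⁻¹ : ℝ) : ℂ) * torusMap 0 (fun _ => 1) θ j))
      (B (fun _ => 0))
    exact h4.trans (by linarith)
  · exact (continuous_const.mul hK.norm).continuousOn.integrableOn_compact isCompact_Icc
  · refine Eventually.of_forall fun θ => ?_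
    refine Tendsto.const_smul ?_ _
    exact (hBat.tendsto.comp (hscale _)).mul_const _

end Integrand

/-! ### The leading term of `Q_k` and the conclusion -/

section MainTerm

variable (F : Type*) [Field F] [Fintype F]

theorem torusIntegral_kernel_one (k : ℕ) :
    torusIntegral (kernel 1 : (Fin k → ℂ) → ℂ) (fun _ => 0) (fun _ => 1)
      = (2 * π * Complex.I) ^ k * (k.factorial * ((-2) ^ (k * (k - 1) / 2) * (2 ^ k
        * ∏ j ∈ Finset.Icc 1 k, ((j.factorial : ℂ) / ((2 * j).factorial : ℂ))))) := by
  rw [← vandermonde_id_mul_prod, ← det_expCoeff, ← torusIntegral_vandermonde_mul_exp]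
  unfold kernel
  simp only [Complex.ofReal_one, one_mul]

theorem Q_eq {k : ℕ} (hk : 1 ≤ k) {r : ℝ} (hr0 : 0 < r) (hr1 : r < 1 / 4)
    (hr2 : r < π / Real.log (q F)) {x : ℝ} (hx : 0 < x * Real.log (q F) / 2)
    (hxr : (x * Real.log (q F) / 2)⁻¹ ≤ r) :
    Q F k r x = (x : ℂ) ^ (k * (k + 1) / 2) * ((-1) ^ (k * (k - 1) / 2) * 2 ^ k
      / (k.factorial : ℂ) * (1 / (2 * π * Complex.I) ^ k) * (2 ^ k)⁻¹
      * ((Real.log (q F) : ℂ) / 2) ^ (k * (k + 1) / 2)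
      * torusIntegral (fun w : Fin k → ℂ =>
            regularPart F (fun j => (((x * Real.log (q F) / 2)⁻¹ : ℝ) : ℂ) * w j) * kernel 1 w)
          (fun _ => 0) (fun _ => 1)) := by
  rw [Q, torusIntegral_congr hr0.le
    (fun z hz => integrand_eq F hk x fun j => (hz j).trans_lt hr2), torusIntegral_const_mul,
    torusIntegral_regularPart_mul_kernel F k hr1 hr2 hx hxr]
  have h : ((x * Real.log (q F) / 2 : ℝ) : ℂ) = x * ((Real.log (q F) : ℂ) / 2) := by
    push_cast
    ring
  rw [h, mul_pow]
  ring

/-- `Q_k(x)` is asymptotic to its leading term as `x → ∞`. -/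
theorem isEquivalent_Q {k : ℕ} (hk : 1 ≤ k) {r : ℝ} (hr0 : 0 < r) (hr1 : r < 1 / 4)
    (hr2 : r < π / Real.log (q F)) :
    (fun x : ℝ => Q F k r x) ~[atTop] fun x : ℝ => (x : ℂ) ^ (k * (k + 1) / 2)
      * (eulerA F (fun _ : Fin k => (0 : ℂ))
        * ∏ j ∈ Finset.Icc 1 k, ((j.factorial : ℂ) / ((2 * j).factorial : ℂ))) := by
  have hlog := log_q_pos F
  have hlam : Tendsto (fun x : ℝ => x * Real.log (q F) / 2) atTop atTop :=
    (tendsto_id.atTop_mul_const hlog).atTop_div_const two_pos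
  have hJ := (tendsto_torusIntegral_scaled hr0 (continuousOn_regularPart F k hr0.le hr1 hr2)
    (continuous_kernel_torusMap k 1 one_pos)).comp hlam
  rw [regularPart_zero, torusIntegral_kernel_one] at hJ
  have hD := hJ.const_mul ((-1) ^ (k * (k - 1) / 2) * 2 ^ k
      / (k.factorial : ℂ) * (1 / (2 * π * Complex.I) ^ k) * (2 ^ k)⁻¹
      * ((Real.log (q F) : ℂ) / 2) ^ (k * (k + 1) / 2))
  have hm := mul_succ_div_two k
  -- The powers of `log q` cancel. The signs combine to `2^{k(k-1)/2}`, which with the remaining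
  -- `2^k` cancels `2^{-k(k+1)/2}`.
  have hconst : (-1) ^ (k * (k - 1) / 2) * 2 ^ k
      / (k.factorial : ℂ) * (1 / (2 * π * Complex.I) ^ k) * (2 ^ k)⁻¹
      * ((Real.log (q F) : ℂ) / 2) ^ (k * (k + 1) / 2)
      * (eulerA F (fun _ : Fin k => (0 : ℂ)) * ((Real.log (q F) : ℂ)⁻¹) ^ (k * (k + 1) / 2)
        * ((2 * π * Complex.I) ^ k * (k.factorial * ((-2) ^ (k * (k - 1) / 2) * (2 ^ k
        * ∏ j ∈ Finset.Icc 1 k, ((j.factorial : ℂ) / ((2 * j).factorial : ℂ)))))))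
      = eulerA F (fun _ : Fin k => (0 : ℂ))
        * ∏ j ∈ Finset.Icc 1 k, ((j.factorial : ℂ) / ((2 * j).factorial : ℂ)) := by
    have h1 : (Real.log (q F) : ℂ) ≠ 0 := Complex.ofReal_ne_zero.2 hlog.ne'
    have h2 : (k.factorial : ℂ) ≠ 0 := Nat.cast_ne_zero.2 (Nat.factorial_ne_zero _)
    have h3 := pow_ne_zero k Complex.two_pi_I_ne_zero
    have h4 : ((-1 : ℂ)) ^ (k * (k - 1) / 2) * (-2) ^ (k * (k - 1) / 2)
        = 2 ^ (k * (k - 1) / 2) := by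
      rw [← mul_pow]
      norm_num
    rw [div_pow, inv_pow, hm, pow_add (2 : ℂ) k, ← h4]
    have h5 : (-1 : ℂ) ^ (k * (k - 1) / 2) ≠ 0 := pow_ne_zero _ (by norm_num)
    have h6 : (-2 : ℂ) ^ (k * (k - 1) / 2) ≠ 0 := pow_ne_zero _ (by norm_num)
    have h7 := pow_ne_zero (k + k * (k - 1) / 2) h1
    generalize (Real.log (q F) : ℂ) ^ (k + k * (k - 1) / 2) = L at *
    generalize (2 * π * Complex.I) ^ k = W at *
    generalize (-1 : ℂ) ^ (k * (k - 1) / 2) = U at *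
    generalize (-2 : ℂ) ^ (k * (k - 1) / 2) = V at *
    field_simp
  rw [hconst] at hD
  -- Convergence to a constant is asymptotic equivalence only when the constant is nonzero.
  have hne : eulerA F (fun _ : Fin k => (0 : ℂ))
      * ∏ j ∈ Finset.Icc 1 k, ((j.factorial : ℂ) / ((2 * j).factorial : ℂ)) ≠ 0 := by
    refine mul_ne_zero (eulerA_zero_ne_zero F k) (Finset.prod_ne_zero_iff.2 fun j _ => ?_)
    exact div_ne_zero (Nat.cast_ne_zero.2 (Nat.factorial_ne_zero _))
      (Nat.cast_ne_zero.2 (Nat.factorial_ne_zero _))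
  have hequiv := (IsEquivalent.refl (u := fun x : ℝ => (x : ℂ) ^ (k * (k + 1) / 2))
    (l := atTop)).mul ((isEquivalent_const_iff_tendsto hne).2 hD)
  refine hequiv.congr_left ?_
  filter_upwards [hlam.eventually_gt_atTop 0,
    (tendsto_inv_atTop_zero.comp hlam).eventually (ge_mem_nhds hr0)] with x hx hxr
  exact (Q_eq F hk hr0 hr1 hr2 hx hxr).symm

theorem tendsto_logb_q_pow :
    Tendsto (fun g : ℕ => Real.logb (q F) ((q F : ℝ) ^ (2 * g + 1))) atTop atTop := by
  have hq : (1 : ℝ) < q F := by exact_mod_cast one_lt_q F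
  have h (g : ℕ) : Real.logb (q F) ((q F : ℝ) ^ (2 * g + 1)) = ((2 * g + 1 : ℕ) : ℝ) := by
    rw [Real.logb_pow, Real.logb_self_eq_one hq, mul_one]
  simp only [h]
  exact tendsto_natCast_atTop_atTop.comp
    (tendsto_atTop_mono (fun g => by simp only [id]; omega) tendsto_id)

theorem sum_ensemble_logb_polyNorm {n : ℕ} (hn : 2 ≤ n) (f : ℝ → ℂ) :
    ∑ D ∈ ensemble F n, f (Real.logb (q F) (polyNorm D))
      = (q F : ℂ) ^ n / zetaA F 2 * f (Real.logb (q F) ((q F : ℝ) ^ n)) := by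
  rw [← card_ensemble hn, ← nsmul_eq_mul, ← Finset.sum_const]
  refine Finset.sum_congr rfl fun D hD => ?_
  have hD' := (mem_ensemble.1 hD).1
  rw [polyNorm, if_neg hD'.1.ne_zero, hD'.2]

end MainTerm

end HyperellipticMoments

end

theorem mainTheorem1 (F : Type*) [Field F] [Fintype F] (hodd : Odd (HyperellipticMoments.q F))
    (k : ℕ) (hk : 1 ≤ k) (r : ℝ) (hr0 : 0 < r) (hr1 : r < 1 / 4)
    (hr2 : r < π / Real.log (HyperellipticMoments.q F))
    (hconj : HyperellipticMoments.MomentConjecture F k r) :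
    (fun g : ℕ => ∑ D ∈ HyperellipticMoments.ensemble F (2 * g + 1),
        HyperellipticMoments.LFunction D (1 / 2) ^ k)
      ~[atTop]
    (fun g : ℕ =>
      ((HyperellipticMoments.q F : ℂ) ^ (2 * g + 1)) / HyperellipticMoments.zetaA F 2
        * ((Real.logb (HyperellipticMoments.q F)
              ((HyperellipticMoments.q F : ℝ) ^ (2 * g + 1)) : ℝ) : ℂ) ^ (k * (k + 1) / 2)
        * HyperellipticMoments.eulerA F (fun _ : Fin k => (0 : ℂ))
        * ∏ j ∈ Finset.Icc 1 k, ((j.factorial : ℂ) / ((2 * j).factorial : ℂ))) := by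
  have hQ := (IsEquivalent.refl (u := fun g : ℕ =>
      (HyperellipticMoments.q F : ℂ) ^ (2 * g + 1) / HyperellipticMoments.zetaA F 2)
    (l := atTop)).mul ((HyperellipticMoments.isEquivalent_Q F hk hr0 hr1 hr2).comp_tendsto
      (HyperellipticMoments.tendsto_logb_q_pow F))
  refine (hconj.congr_right ?_).trans (hQ.congr_right ?_)
  -- The count of square-free polynomials requires degree `2g + 1 ≥ 2`, hence `g ≥ 1`.
  · filter_upwards [eventually_ge_atTop 1] with g hg
    exact HyperellipticMoments.sum_ensemble_logb_polyNorm F (by omega) _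
  · refine Eventually.of_forall fun g => ?_
    simp only [Pi.mul_apply, Function.comp_apply]
    ring
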